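/- **Setting.** Consider a finite two-player zero-sum extensive-form game with chance and perfect recall. Its histories are finite sequences of elements of a finite set $\mathcal A$; $\mathcal Z$ is the set of terminal histories, player 1 has utility $r_1:\mathcal Z\to\mathbb R$, and $r_2=-r_1$. The histories at which player $i\in\{1,2\}$ acts are partitioned into a set $\mathcal S_i$ of information states; all histories in $s\in\mathcal S_i$ have the same set $A(s)\subseteq\mathcal A$ of available actions and (perfect recall) the same sequence of earlier information states of player $i$ and of actions of player $i$ taken there. A policy $\sigma_i$ of player $i$ assigns to each $s\in\mathcal S_i$ a probability distribution $\sigma_i(s)=(\sigma_i(s,a))_{a\in A(s)}$. For a profile $\sigma=(\sigma_1,\sigma_2)$ let $\eta^\sigma(z)$ be the probability of reaching $z$, let $\eta^\sigma_i(h)$, $\eta^\sigma_{-i}(h)$ be the contributions of player $i$, respectively of the opponent and chance, to the probability of reaching $h$, let $\eta_i^\sigma(h,z)$ be the contribution of $i$ to the probability of going from $h$ to $z$ (zero if $z$ is not reachable from $h$), and let $u_i(\sigma)=\sum_{z\in\mathcal Z}\eta^\sigma(z)r_i(z)$. The counterfactual value of $a\in A(s)$, $s\in\mathcal S_i$, is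 $$v_i^\sigma(s,a)=\sum_{h\in s,\ z\in\mathcal Z}\eta_i^\sigma(ha,z)\,\eta_{-i}^\sigma(z)\,r_i(z).$$ Let $U$ be a real number such that $|r_1(z)|\le U$ for all $z\in\mathcal Z$, or such that $|v_i^\sigma(s,a)|\le U$ for all profiles $\sigma$, all $i$, $s\in\mathcal S_i$ and $a\in A(s)$. Let $\sigma^k=(\sigma_{1,k},\sigma_{2,k})$ be the profile played in round $k=1,2,\dots$. The cumulative counterfactual regret vector at $s\in\mathcal S_i$ is $R_k(s)\in\mathbb R^{A(s)}$, $$R_k(s)_a=\sum_{j=1}^k\Big(v_i^{\sigma^j}(s,a)-\sum_{b\in A(s)}\sigma_{i,j}(s,b)\,v_i^{\sigma^j}(s,b)\Big),\qquad R_0(s)=0.$$ With $\tilde A_i=\prod_{s\in\mathcal S_i}A(s)$ the set of pure strategies of player $i$, the external regret of player $i$ after $t$ rounds is $$R^{\mathrm{EXT}}_{i,t}=\max_{a^*\in\tilde A_i}\sum_{k=1}^t\mathbb E_{a\sim\sigma_{i,k}}\big[u_i(a^*,\sigma_{-i,k})-u_i(a,\sigma_{-i,k})\big],$$ where $a\sim\sigma_{i,k}$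 draws the actions at the different information states independently. A profile $\sigma$ is an $\varepsilon$-Nash equilibrium if $u_i(\sigma_i',\sigma_{-i})\le u_i(\sigma)+\varepsilon$ for both $i$ and all policies $\sigma'_i$. **Algorithm.** Let $p>2$ and let $f(x)_j=(x_j^+)^{p-1}$, where $x^+=\max\{x,0\}$. Let $\varphi(s,a)\in\mathbb R^d$ be features of the pairs $(s,a)$ and let $y_{k}:\mathbb R^d\to\mathbb R$, $k\ge0$, be arbitrary functions (regret estimators), with estimates $\tilde R_{k}(s)=(y_{k}(\varphi(s,a)))_{a\in A(s)}$. $f$-RCFR plays in each round $k\ge1$, for both players and at each $s\in\mathcal S_i$, the policy $\sigma_{i,k}(s)\propto f(\tilde R_{k-1}(s))$ if $f(\tilde R_{k-1}(s))\ne0$, and an arbitrary distribution on $A(s)$ otherwise. **Claim.** Let $g(x)_j=0$ if $x_j\le0$ and $g(x)_j=2x_j^{p-1}/\|x^+\|_p^{p-2}$ otherwise; let $t\ge1$, let $\epsilon_i(s)=\sum_{k=1}^t\|g(R_{k-1}(s))-g(\tilde R_{k-1}(s))\|_1$ for $s\in\mathcal S_i$, and let $\epsilon_i^*=\max_{s\in\mathcal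 S_i}\epsilon_i(s)$. If $f$-RCFR is run as above, then for both players $i\in\{1,2\}$ $$\frac1tR^{\mathrm{EXT}}_{i,t}\le\varepsilon_{i,t}:=\frac1t\sum_{s\in\mathcal S_i}\sqrt{t(p-1)4U^2(|A(s)|-1)^{2/p}+2U\epsilon_i(s)},$$ $$\varepsilon_{i,t}\le\frac1t|\mathcal S_i|\sqrt{t(p-1)4U^2(|\mathcal A|-1)^{2/p}+2U\epsilon_i^*}$$ (the right-hand side is read as $0$ if $\mathcal S_i=\emptyset$). Furthermore, every profile $\bar\sigma^t$ of average sequence-weight policies, that is, $\bar\sigma_i^t(s)\propto\sum_{k=1}^t\sum_{h\in s}\eta_i^{\sigma^k}(h)\,\sigma_{i,k}(s)$ for both $i$ and all $s\in\mathcal S_i$ (arbitrary where all these weights vanish), is an $(\varepsilon_{1,t}+\varepsilon_{2,t})$-Nash equilibrium. -/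

import Mathlib

/-- A finite game tree. Histories are finite sequences of actions (or chance outcomes) from `α`.
`player h = some 0`, `some 1`, `none` means that player 1, player 2, chance acts at `h`. -/
structure GameTree (α : Type*) [DecidableEq α] [Fintype α] where
  hist : Finset (List α)
  nil_mem : [] ∈ hist
  prefix_mem : ∀ (h : List α) (a : α), h ++ [a] ∈ hist → h ∈ hist
  player : List α → Option (Fin 2)

namespace GameTree

variable {α : Type*} [DecidableEq α] [Fintype α] (T : GameTree α)

/-- The set `A(h)` of actions available at the history `h`. -/
def actionsAt (h : List α) : Finset α := Finset.univ.filter fun a => h ++ [a] ∈ T.hist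

/-- The terminal histories: no valid actions. -/
def terminals : Finset (List α) := T.hist.filter fun z => T.actionsAt z = ∅

/-- The non-terminal histories at which player `i` acts. -/
def playerHist (i : Fin 2) : Finset (List α) :=
  T.hist.filter fun h => T.actionsAt h ≠ ∅ ∧ T.player h = some i

end GameTree

/-- The list of pairs (preceding history, action taken there) along the history `h`,
e.g. `[([], a), ([a], b)]` for `h = [a, b]`. -/
def historySteps {α : Type*} (h : List α) : List (List α × α) := h.inits.zip h

/-- A finite two-player zero-sum extensive-form game with chance and perfect recall. -/
structure ZeroSumEFG (α : Type*) [DecidableEq α] [Fintype α] extends GameTree α where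
  /-- the fixed policy of chance -/
  chance : List α → α → ℝ
  chance_nonneg : ∀ h ∈ hist, toGameTree.actionsAt h ≠ ∅ → player h = none →
    ∀ a ∈ toGameTree.actionsAt h, 0 ≤ chance h a
  chance_sum : ∀ h ∈ hist, toGameTree.actionsAt h ≠ ∅ → player h = none →
    ∑ a ∈ toGameTree.actionsAt h, chance h a = 1
  /-- the information partition of each player's histories -/
  infoPartition : (i : Fin 2) → Finpartition (toGameTree.playerHist i)
  same_actions : ∀ i, ∀ s ∈ (infoPartition i).parts, ∀ h ∈ s, ∀ h' ∈ s,
    toGameTree.actionsAt h = toGameTree.actionsAt h'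
  /-- perfect recall: the sequence of own earlier information states and of the own actions taken
  there is the same for all histories in an information state -/
  perfect_recall : ∀ i, ∀ s ∈ (infoPartition i).parts, ∀ h ∈ s, ∀ h' ∈ s,
    ((historySteps h).filter fun q => player q.1 = some i).map
        (fun q => ((infoPartition i).part q.1, q.2)) =
      ((historySteps h').filter fun q => player q.1 = some i).map
        (fun q => ((infoPartition i).part q.1, q.2))
  /-- the utility of player 1 at terminal histories -/
  utility : List α → ℝ

namespace ZeroSumEFG

variable {α : Type*} [DecidableEq α] [Fintype α] (G : ZeroSumEFG α)

/-- The set `S_i` of information states of player `i`. -/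
def infoStates (i : Fin 2) : Finset (Finset (List α)) := (G.infoPartition i).parts

/-- The set `A(s)` of actions at the information state `s` (the common value of `A(h)`, `h ∈ s`). -/
def actions (s : Finset (List α)) : Finset α := s.biUnion G.actionsAt

/-- The utility `r_i`, with `r_2 = -r_1`. -/
def payoff (i : Fin 2) (z : List α) : ℝ := if i = 0 then G.utility z else - G.utility z

/-- A policy (behavioral strategy) of player `i`. Only the values at `s ∈ S_i` and `a ∈ A(s)` have a
meaning; nothing below depends on the others. -/
structure Strategy (i : Fin 2) where
  prob : Finset (List α) → α → ℝ
  nonneg : ∀ s ∈ G.infoStates i, ∀ a ∈ G.actions s, 0 ≤ prob s a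
  sum_eq_one : ∀ s ∈ G.infoStates i, ∑ a ∈ G.actions s, prob s a = 1

/-- A strategy profile. -/
abbrev Profile := (i : Fin 2) → G.Strategy i

/-- The probability that action `a` is taken at `h` under `σ`. -/
def stepProb (σ : G.Profile) (h : List α) (a : α) : ℝ :=
  match G.player h with
  | none => G.chance h a
  | some j => (σ j).prob ((G.infoPartition j).part h) a

/-- The contribution of the players in `C` to the probability of going from `h` to `z` under `σ`;
it is `0` if `z` cannot be reached from `h`. -/
def reach (σ : G.Profile) (C : Finset (Option (Fin 2))) (h z : List α) : ℝ :=
  if h <+: z then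
    ((((historySteps z).drop h.length).filter fun q => G.player q.1 ∈ C).map
      fun q => G.stepProb σ q.1 q.2).prod
  else 0

/-- The expected value of `σ` to player `i`. -/
def value (i : Fin 2) (σ : G.Profile) : ℝ :=
  ∑ z ∈ G.terminals, G.reach σ Finset.univ [] z * G.payoff i z

/-- The counterfactual value of action `a` at the information state `s` of player `i`:
`∑_{h ∈ s, z} η_i(ha, z) η_{-i}(z) r_i(z)`. -/
def cfValue (i : Fin 2) (σ : G.Profile) (s : Finset (List α)) (a : α) : ℝ :=
  ∑ h ∈ s, ∑ z ∈ G.terminals,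
    G.reach σ {some i} (h ++ [a]) z * G.reach σ {some i}ᶜ [] z * G.payoff i z

/-- The instantaneous counterfactual regret. -/
def cfRegret (i : Fin 2) (σ : G.Profile) (s : Finset (List α)) (a : α) : ℝ :=
  G.cfValue i σ s a - ∑ b ∈ G.actions s, (σ i).prob s b * G.cfValue i σ s b

/-- The cumulative counterfactual regret vector at `s` after the first `k` rounds, where the
profile played in round `j + 1` is `σ j`. -/
def cumRegret (i : Fin 2) (σ : ℕ → G.Profile) (k : ℕ) (s : Finset (List α)) :
    G.actions s → ℝ :=
  fun a => ∑ j ∈ Finset.range k, G.cfRegret i (σ j) s a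

/-- A pure strategy of player `i`: an action at each information state. -/
abbrev PureStrategy (i : Fin 2) := (s : G.infoStates i) → G.actions s.1

/-- The policy that plays the pure strategy `a`. -/
def PureStrategy.toStrategy {G : ZeroSumEFG α} {i : Fin 2} (a : G.PureStrategy i) :
    G.Strategy i where
  prob s b := if hs : s ∈ G.infoStates i then (if (a ⟨s, hs⟩ : α) = b then 1 else 0) else 0
  nonneg s hs b _ := by
    simp only [hs, dite_true]
    split_ifs <;> norm_num
  sum_eq_one s hs := by
    simp [hs]

/-- The distribution over pure strategies that is induced by a policy: the actions at the different
information states are drawn independently. -/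
def pureProb {G : ZeroSumEFG α} {i : Fin 2} (τ : G.Strategy i) (a : G.PureStrategy i) : ℝ :=
  ∏ s : G.infoStates i, τ.prob s.1 (a s)

/-- The expected regret of player `i` under the profile `σ` for not playing the pure strategy `a'`,
in the induced normal form: `E_{a ∼ σ_i} [u_i(a', σ_{-i}) - u_i(a, σ_{-i})]`. -/
noncomputable def pureRegret (i : Fin 2) (σ : G.Profile) (a' : G.PureStrategy i) : ℝ :=
  ∑ a : G.PureStrategy i, pureProb (σ i) a *
    (G.value i (Function.update σ i a'.toStrategy) - G.value i (Function.update σ i a.toStrategy))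

/-- The cumulative external regret of player `i` after `t` rounds, a maximum over the (finitely
many) pure strategies. -/
noncomputable def externalRegret (i : Fin 2) (σ : ℕ → G.Profile) (t : ℕ) : ℝ :=
  ⨆ a' : G.PureStrategy i, ∑ k ∈ Finset.range t, G.pureRegret i (σ k) a'

/-- `σ` is an `ε`-Nash equilibrium: no player gains more than `ε` by a unilateral deviation. -/
def IsNash (ε : ℝ) (σ : G.Profile) : Prop :=
  ∀ (i : Fin 2) (τ : G.Strategy i), G.value i (Function.update σ i τ) ≤ G.value i σ + ε

/-- `σbar` is a profile of average sequence-weight policies for the first `t` rounds: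
`σbar_i(s) ∝ ∑_k ∑_{h ∈ s} η_i^{σ_k}(h) σ_{i,k}(s)`, arbitrary where these weights all vanish. -/
def IsAverage (σ : ℕ → G.Profile) (t : ℕ) (σbar : G.Profile) : Prop :=
  ∀ i, ∀ s ∈ G.infoStates i, ∀ a ∈ G.actions s,
    (∑ k ∈ Finset.range t, ∑ h ∈ s, G.reach (σ k) {some i} [] h) * (σbar i).prob s a =
      ∑ k ∈ Finset.range t, ∑ h ∈ s, G.reach (σ k) {some i} [] h * (σ k i).prob s a

/-- The regret estimates at `s` predicted by the estimator `y` from the features `φ(s, a)`. -/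
def regretEst {d : ℕ} (φ : Finset (List α) → α → (Fin d → ℝ)) (y : (Fin d → ℝ) → ℝ)
    (s : Finset (List α)) : G.actions s → ℝ :=
  fun a => y (φ s a)

/-- The play `σ` is generated by `f`-RCFR with the regret estimators `y`: in round `k + 1`, both
players play at each information state the policy proportional to `f` of the estimate (made by `y k`)
of the cumulative regret after `k` rounds, and an arbitrary policy where `f` of the estimate is `0`. -/
def IsRCFR (f : (s : Finset (List α)) → (G.actions s → ℝ) → (G.actions s → ℝ)) {d : ℕ}
    (φ : Finset (List α) → α → (Fin d → ℝ)) (y : ℕ → (Fin d → ℝ) → ℝ)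
    (σ : ℕ → G.Profile) : Prop :=
  ∀ (k : ℕ) (i : Fin 2), ∀ s ∈ G.infoStates i, f s (G.regretEst φ (y k) s) ≠ 0 →
    ∀ a : G.actions s, (σ k i).prob s a =
      f s (G.regretEst φ (y k) s) a / ∑ b, f s (G.regretEst φ (y k) s) b

end ZeroSumEFG

/-- The polynomial link function `f(x)_j = (x_j^+)^{p-1}`. -/
noncomputable def polyLink {ι : Type*} (p : ℝ) (x : ι → ℝ) : ι → ℝ :=
  fun j => (max (x j) 0) ^ (p - 1)

/-- `g(x)_j = 0` if `x_j ≤ 0`, and `g(x)_j = 2 x_j^{p-1} / ‖x^+‖_p^{p-2}` otherwise. -/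
noncomputable def polyGrad {ι : Type*} [Fintype ι] (p : ℝ) (x : ι → ℝ) : ι → ℝ :=
  fun j => if x j ≤ 0 then 0
    else 2 * x j ^ (p - 1) / ((∑ l, (max (x l) 0) ^ p) ^ (1 / p)) ^ (p - 2)

namespace ZeroSumEFG

variable {α : Type*} [DecidableEq α] [Fintype α] (G : ZeroSumEFG α)

/-- The cumulative approximation error at `s`: `∑_{k=1}^t ‖g(R_{k-1}(s)) - g(R̃_{k-1}(s))‖_1`. -/
noncomputable def approxError (p : ℝ) {d : ℕ} (φ : Finset (List α) → α → (Fin d → ℝ))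
    (y : ℕ → (Fin d → ℝ) → ℝ) (σ : ℕ → G.Profile) (t : ℕ) (i : Fin 2)
    (s : Finset (List α)) : ℝ :=
  ∑ k ∈ Finset.range t, ∑ a : G.actions s,
    |polyGrad p (G.cumRegret i σ k s) a - polyGrad p (G.regretEst φ (y k) s) a|

/-- `ε_{i,t} = (1/t) ∑_{s ∈ S_i} √(t (p-1) 4U² (|A(s)|-1)^{2/p} + 2U ε_i(s))`. -/
noncomputable def regretBound (p U : ℝ) {d : ℕ} (φ : Finset (List α) → α → (Fin d → ℝ))
    (y : ℕ → (Fin d → ℝ) → ℝ) (σ : ℕ → G.Profile) (t : ℕ) (i : Fin 2) : ℝ :=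
  1 / (t : ℝ) * ∑ s ∈ G.infoStates i,
    √((t : ℝ) * (p - 1) * 4 * U ^ 2 * (((G.actions s).card : ℝ) - 1) ^ (2 / p) +
      2 * U * G.approxError p φ y σ t i s)

end ZeroSumEFG

/-! The argument has a local part, at one information state, and a global part that assembles the
states.

Local part: take the potential `Φ(x) = ‖x⁺‖_p²`, whose gradient is `g`. It satisfies `Φ(x + r) ≤
Φ(x) + ⟨g(x), r⟩ + (p - 1)‖r‖_p²` (`polyPotential_add_le`). Since `g` is a multiple of the link `f`,
a policy proportional to `f(R̃)` makes `g(R̃)` orthogonal to the instantaneous regret `r`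
(`sum_polyGrad_mul_sub_mean`). Hence `⟨g(R), r⟩ = ⟨g(R) - g(R̃), r⟩ ≤ 2U‖g(R) - g(R̃)‖₁`, while
`‖r‖_p² ≤ 4U²(n - 1)^{2/p}` for `n` actions. Summing over the rounds bounds `Φ(R_t)`, and its square
root bounds every coordinate of `R_t` (`polyPotential_regret_le`).

Global part: the gain from deviating to `τ` is the sum over the information states of the own reach
of `τ` times its counterfactual regret there (`value_update_sub`). The reach lies in `[0, 1]`, so
the local bounds add up to a bound on the gain of every fixed policy. Mixing pure strategies
independently reproduces the policy (`sum_pureProb_mul_value`), so this covers the external regret.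
Average policies realize the averaged own reach, so with zero sums the two players' bounds add up to
the equilibrium gap (`IsAverage.isNash`).

That a bound on utilities bounds counterfactual values follows because the weights in a
counterfactual value are part of a subprobability on terminal histories: that of a player who steers
toward the state (`sum_reach_le_one`). -/

/-! ### Calculus: smoothness of the squared `ℓ^p` norm -/

theorem hasDerivAt_abs_rpow_mul_self {q : ℝ} (hq : 0 < q) (u : ℝ) :
    HasDerivAt (fun u : ℝ => |u| ^ q * u) ((q + 1) * |u| ^ q) u := by
  rcases lt_trichotomy u 0 with h | h | h
  · have h1 := ((hasDerivAt_abs_neg h).rpow_const (p := q) (Or.inl (abs_ne_zero.2 h.ne))).mul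
      (hasDerivAt_id u)
    refine h1.congr_deriv ?_
    have h2 : |u| ^ q = |u| ^ (q - 1) * |u| := by
      rw [← Real.rpow_add_one (abs_ne_zero.2 h.ne), sub_add_cancel]
    simp only [id, h2]
    rw [abs_of_neg h]
    ring
  · subst h
    -- At the kink of `|u|` the product rule fails, but the difference quotient is `|t| ^ q` itself.
    rw [hasDerivAt_iff_tendsto_slope_zero]
    have h1 : Filter.Tendsto (fun t : ℝ => |t| ^ q) (nhdsWithin 0 {0}ᶜ) (nhds 0) := by
      have : ContinuousAt (fun t : ℝ => |t| ^ q) 0 :=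
        (continuous_abs.continuousAt).rpow_const (Or.inr hq.le)
      have h2 := this.tendsto
      simp only [abs_zero, Real.zero_rpow hq.ne'] at h2
      exact h2.mono_left nhdsWithin_le_nhds
    simp only [abs_zero, Real.zero_rpow hq.ne', mul_zero]
    refine h1.congr' ?_
    filter_upwards [self_mem_nhdsWithin] with t ht
    have ht : t ≠ 0 := ht
    simp only [zero_add, sub_zero, smul_eq_mul]
    field_simp
  · have h1 := ((hasDerivAt_abs_pos h).rpow_const (p := q) (Or.inl (abs_ne_zero.2 h.ne'))).mul
      (hasDerivAt_id u)
    refine h1.congr_deriv ?_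
    have h2 : |u| ^ q = |u| ^ (q - 1) * |u| := by
      rw [← Real.rpow_add_one (abs_ne_zero.2 h.ne'), sub_add_cancel]
    simp only [id, h2]
    rw [abs_of_pos h]
    ring

/-- Second order Taylor bound on `[0, 1]`. -/
theorem le_of_second_deriv_le {f f' f'' : ℝ → ℝ} {C : ℝ}
    (hf : ∀ s ∈ Set.Icc (0 : ℝ) 1, HasDerivAt f (f' s) s)
    (hf' : ∀ s ∈ Set.Icc (0 : ℝ) 1, HasDerivAt f' (f'' s) s)
    (hC : ∀ s ∈ Set.Icc (0 : ℝ) 1, f'' s ≤ 2 * C) :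
    f 1 ≤ f 0 + f' 0 + C := by
  have anti : ∀ g g' : ℝ → ℝ, (∀ s ∈ Set.Icc (0 : ℝ) 1, HasDerivAt g (g' s) s) →
      (∀ s ∈ Set.Icc (0 : ℝ) 1, g' s ≤ 0) → AntitoneOn g (Set.Icc 0 1) := by
    intro g g' hg hg'
    refine antitoneOn_of_deriv_nonpos (convex_Icc 0 1)
      (fun s hs => (hg s hs).continuousAt.continuousWithinAt)
      (fun s hs => (hg s (interior_subset hs)).differentiableAt.differentiableWithinAt) ?_
    intro s hs
    rw [(hg s (interior_subset hs)).deriv]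
    exact hg' s (interior_subset hs)
  have h0 : (0 : ℝ) ∈ Set.Icc (0 : ℝ) 1 := by simp
  have h1 : (1 : ℝ) ∈ Set.Icc (0 : ℝ) 1 := by simp
  -- The bound is integrated twice by monotonicity: first `f' - 2Cs` decreases, then `f - f'(0)s -
  -- Cs²` does.
  have hslope : ∀ s ∈ Set.Icc (0 : ℝ) 1, f' s - 2 * C * s ≤ f' 0 := by
    intro s hs
    have := anti (fun s => f' s - 2 * C * s) (fun s => f'' s - 2 * C)
      (fun s hs => by simpa using (hf' s hs).fun_sub ((hasDerivAt_id s).const_mul (2 * C)))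
      (fun s hs => by linarith [hC s hs]) h0 hs hs.1
    simpa using this
  have := anti (fun s => f s - f' 0 * s - C * s ^ 2) (fun s => f' s - f' 0 - C * (2 * s))
    (fun s hs => by
      simpa using ((hf s hs).fun_sub ((hasDerivAt_id s).const_mul (f' 0))).fun_sub
        ((hasDerivAt_pow 2 s).const_mul C))
    (fun s hs => by linarith [hslope s hs]) h0 h1 zero_le_one
  simp at this
  linarith

section LpSmooth

variable {ι : Type*} [Fintype ι]

/-- Hölder with the conjugate exponents `p / (p - 2)` and `p / 2`. It controls the second derivative
of the squared norm along a line. -/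
theorem sum_abs_rpow_mul_sq_le {p : ℝ} (hp : 2 < p) (u y : ι → ℝ) :
    ∑ j, |u j| ^ (p - 2) * y j ^ 2 ≤
      (∑ j, |u j| ^ p) ^ (1 - 2 / p) * (∑ j, |y j| ^ p) ^ (2 / p) := by
  have hpq : (p / (p - 2)).HolderConjugate (p / 2) := by
    rw [Real.holderConjugate_iff]
    refine ⟨by rw [lt_div_iff₀ (by linarith)]; linarith, ?_⟩
    rw [inv_div, inv_div]
    field_simp
    ring
  have h := Real.inner_le_Lp_mul_Lq Finset.univ (fun j => |u j| ^ (p - 2)) (fun j => y j ^ 2) hpq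
  have e1 : ∀ j, |(|u j| ^ (p - 2))| ^ (p / (p - 2)) = |u j| ^ p := by
    intro j
    rw [abs_of_nonneg (by positivity), ← Real.rpow_mul (abs_nonneg _)]
    congr 1
    field_simp [show p - 2 ≠ 0 by linarith]
  have e2 : ∀ j, |y j ^ 2| ^ (p / 2) = |y j| ^ p := by
    intro j
    rw [abs_pow, ← Real.rpow_natCast, ← Real.rpow_mul (abs_nonneg _)]
    congr 1
    push_cast
    ring
  simp only [e1, e2, one_div_div] at h
  convert h using 3
  field_simp

/-- The square of the `ℓ^p` norm is smooth with constant `2 (p - 1)`. -/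
theorem sq_lp_norm_add_le {p : ℝ} (hp : 2 < p) (x y : ι → ℝ) :
    (∑ j, |x j + y j| ^ p) ^ (2 / p) ≤ (∑ j, |x j| ^ p) ^ (2 / p) +
      2 * (∑ j, |x j| ^ p) ^ (2 / p - 1) * (∑ j, |x j| ^ (p - 2) * x j * y j) +
      (p - 1) * (∑ j, |y j| ^ p) ^ (2 / p) := by
  have hp0 : 0 < p := by linarith
  have hY : 0 ≤ (∑ j, |y j| ^ p) ^ (2 / p) := by positivity
  rcases (show 0 ≤ ∑ j, |x j| ^ p by positivity).eq_or_lt' with hS | hS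
  · have hx : ∀ j, x j = 0 := by
      intro j
      have := (Finset.sum_eq_zero_iff_of_nonneg (fun j _ => by positivity)).1 hS j (Finset.mem_univ j)
      simpa [Real.rpow_eq_zero (abs_nonneg _) hp0.ne'] using this
    simp only [hx, zero_add, abs_zero, Real.zero_rpow hp0.ne', Finset.sum_const_zero, mul_zero,
      zero_mul, add_zero]
    rw [Real.zero_rpow (by positivity), zero_add]
    nlinarith
  -- If `y` is collinear with `x`, the line `x + s y` may meet the origin, where the power `2 / p`
  -- cannot be differentiated. There the claim is explicit: `(1 - c)² ≤ 1 - 2c + (p - 1)c²`.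
  by_cases hc : ∃ c : ℝ, ∀ j, y j = -c * x j
  · obtain ⟨c, hc⟩ := hc
    have e1 : ∀ r : ℝ, (∑ j, |r * x j| ^ p) ^ (2 / p) = r ^ 2 * (∑ j, |x j| ^ p) ^ (2 / p) := by
      intro r
      simp only [abs_mul, Real.mul_rpow (abs_nonneg _) (abs_nonneg _), ← Finset.mul_sum]
      rw [Real.mul_rpow (by positivity) hS.le, ← Real.rpow_mul (abs_nonneg _),
        mul_div_cancel₀ _ hp0.ne', Real.rpow_two, sq_abs]
    have e2 : ∑ j, |x j| ^ (p - 2) * x j * (-c * x j) = -c * ∑ j, |x j| ^ p := by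
      rw [Finset.mul_sum]
      refine Finset.sum_congr rfl fun j _ => ?_
      rcases eq_or_ne (x j) 0 with h | h
      · simp [h, Real.zero_rpow hp0.ne']
      · have : |x j| ^ p = |x j| ^ (p - 2) * x j ^ 2 := by
          rw [← sq_abs, ← Real.rpow_two, ← Real.rpow_add (abs_pos.2 h), sub_add_cancel]
        rw [this]; ring
    have e3 : (∑ j, |x j| ^ p) ^ (2 / p) = (∑ j, |x j| ^ p) ^ (2 / p - 1) * ∑ j, |x j| ^ p := by
      rw [← Real.rpow_add_one hS.ne', sub_add_cancel]
    have e4 : ∀ j, x j + -c * x j = (1 - c) * x j := fun j => by ring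
    simp only [hc, e4, e1, e2]
    have hX : 0 ≤ (∑ j, |x j| ^ p) ^ (2 / p) := by positivity
    have : 2 * (∑ j, |x j| ^ p) ^ (2 / p - 1) * (-c * ∑ j, |x j| ^ p) =
      -2 * c * (∑ j, |x j| ^ p) ^ (2 / p) := by rw [e3]; ring
    rw [this]
    nlinarith [mul_nonneg (sq_nonneg c) hX]
  · have hF0 : ∀ s : ℝ, 0 < ∑ j, |x j + s * y j| ^ p := by
      intro s
      refine (show 0 ≤ ∑ j, |x j + s * y j| ^ p by positivity).lt_of_ne' fun h0 => ?_
      have hz : ∀ j, x j + s * y j = 0 := by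
        intro j
        have := (Finset.sum_eq_zero_iff_of_nonneg (fun j _ => by positivity)).1 h0 j
          (Finset.mem_univ j)
        simpa [Real.rpow_eq_zero (abs_nonneg _) hp0.ne'] using this
      rcases eq_or_ne s 0 with hs | hs
      · subst hs
        simp only [zero_mul, add_zero] at h0
        exact hS.ne' h0
      · exact hc ⟨1 / s, fun j => by field_simp; linarith [hz j]⟩
    have hl : ∀ (j : ι) (s : ℝ), HasDerivAt (fun s : ℝ => x j + s * y j) (y j) s := by
      intro j s
      simpa using ((hasDerivAt_id s).mul_const (y j)).const_add (x j)
    have hF : ∀ s, HasDerivAt (fun s => ∑ j, |x j + s * y j| ^ p)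
        (p * ∑ j, |x j + s * y j| ^ (p - 2) * (x j + s * y j) * y j) s := by
      intro s
      refine (HasDerivAt.fun_sum fun j _ =>
        (hasDerivAt_abs_rpow (x j + s * y j) (by linarith : 1 < p)).comp s (hl j s)).congr_deriv ?_
      rw [Finset.mul_sum]
      exact Finset.sum_congr rfl fun j _ => by ring
    have hF' : ∀ s, HasDerivAt (fun s => ∑ j, |x j + s * y j| ^ (p - 2) * (x j + s * y j) * y j)
        ((p - 1) * ∑ j, |x j + s * y j| ^ (p - 2) * y j ^ 2) s := by
      intro s
      refine (HasDerivAt.fun_sum fun j _ =>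
        (((hasDerivAt_abs_rpow_mul_self (by linarith : 0 < p - 2) (x j + s * y j)).comp s
          (hl j s)).mul_const (y j))).congr_deriv ?_
      rw [Finset.mul_sum]
      exact Finset.sum_congr rfl fun j _ => by ring
    have h1 : ∀ s, HasDerivAt (fun s => (∑ j, |x j + s * y j| ^ p) ^ (2 / p))
        (2 * (∑ j, |x j + s * y j| ^ p) ^ (2 / p - 1) *
          ∑ j, |x j + s * y j| ^ (p - 2) * (x j + s * y j) * y j) s := by
      intro s
      refine ((hF s).rpow_const (Or.inl (hF0 s).ne')).congr_deriv ?_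
      field_simp
    have h2 : ∀ s, HasDerivAt (fun s => 2 * (∑ j, |x j + s * y j| ^ p) ^ (2 / p - 1) *
          ∑ j, |x j + s * y j| ^ (p - 2) * (x j + s * y j) * y j)
        (2 * ((2 - p) * (∑ j, |x j + s * y j| ^ p) ^ (2 / p - 1 - 1) *
          (∑ j, |x j + s * y j| ^ (p - 2) * (x j + s * y j) * y j) ^ 2) +
        2 * (p - 1) * ((∑ j, |x j + s * y j| ^ p) ^ (2 / p - 1) *
          ∑ j, |x j + s * y j| ^ (p - 2) * y j ^ 2)) s := by
      intro s
      refine ((((hF s).rpow_const (Or.inl (hF0 s).ne')).const_mul 2).mul (hF' s)).congr_deriv ?_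
      field_simp
    have h3 := le_of_second_deriv_le (C := (p - 1) * (∑ j, |y j| ^ p) ^ (2 / p))
      (fun s _ => h1 s) (fun s _ => h2 s) (fun s _ => ?_)
    · simpa using h3
    -- The square in the second derivative carries the factor `2 - p < 0` and is dropped. In the
    -- other term Hölder's power `1 - 2 / p` cancels `2 / p - 1`.
    · have hneg : 2 * ((2 - p) * (∑ j, |x j + s * y j| ^ p) ^ (2 / p - 1 - 1) *
          (∑ j, |x j + s * y j| ^ (p - 2) * (x j + s * y j) * y j) ^ 2) ≤ 0 := by
        have : 0 ≤ (∑ j, |x j + s * y j| ^ p) ^ (2 / p - 1 - 1) *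
          (∑ j, |x j + s * y j| ^ (p - 2) * (x j + s * y j) * y j) ^ 2 := by positivity
        nlinarith
      have hH : (∑ j, |x j + s * y j| ^ p) ^ (2 / p - 1) *
          ∑ j, |x j + s * y j| ^ (p - 2) * y j ^ 2 ≤ (∑ j, |y j| ^ p) ^ (2 / p) := by
        refine (mul_le_mul_of_nonneg_left (sum_abs_rpow_mul_sq_le hp _ y)
          (Real.rpow_nonneg (hF0 s).le _)).trans_eq ?_
        rw [← mul_assoc, ← Real.rpow_add (hF0 s)]
        simp
      have := mul_le_mul_of_nonneg_left hH (by linarith : 0 ≤ 2 * (p - 1))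
      linarith

end LpSmooth

/-! ### Regret matching with estimated regrets -/

section RegretMatching

variable {ι : Type*} [Fintype ι]

/-- The potential `‖x^+‖_p^2`, whose gradient is `polyGrad p`. -/
noncomputable def polyPotential (p : ℝ) (x : ι → ℝ) : ℝ :=
  (∑ l, (max (x l) 0) ^ p) ^ (2 / p)

/-- The factor does not depend on `j`, so normalizing the link or the gradient gives the same
policy. -/
theorem polyGrad_eq_mul_polyLink {p : ℝ} (hp : 2 < p) (x : ι → ℝ) (j : ι) :
    polyGrad p x j = 2 * (∑ l, (max (x l) 0) ^ p) ^ (2 / p - 1) * polyLink p x j := by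
  have hS : 0 ≤ ∑ l, (max (x l) 0) ^ p :=
    Finset.sum_nonneg fun l _ => Real.rpow_nonneg (le_max_right _ _) _
  unfold polyGrad polyLink
  split_ifs with h
  · rw [max_eq_right h, Real.zero_rpow (by linarith), mul_zero]
  · rw [max_eq_left (not_le.1 h).le, ← Real.rpow_mul hS,
      show 1 / p * (p - 2) = -(2 / p - 1) by field_simp; ring, Real.rpow_neg hS, div_inv_eq_mul]
    ring

/-- Positive parts need no calculus of their own: `(x + y)⁺ ≤ |x⁺ + y|` coordinatewise, so
smoothness of the full norm at `x⁺` suffices. -/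
theorem polyPotential_add_le {p : ℝ} (hp : 2 < p) (x y : ι → ℝ) :
    polyPotential p (x + y) ≤ polyPotential p x + ∑ j, polyGrad p x j * y j +
      (p - 1) * (∑ j, |y j| ^ p) ^ (2 / p) := by
  have h := sq_lp_norm_add_le hp (fun j => max (x j) 0) y
  have hmono : polyPotential p (x + y) ≤ (∑ j, |max (x j) 0 + y j| ^ p) ^ (2 / p) := by
    refine Real.rpow_le_rpow
      (Finset.sum_nonneg fun l _ => Real.rpow_nonneg (le_max_right _ _) _)
      (Finset.sum_le_sum fun l _ => Real.rpow_le_rpow (le_max_right _ _) ?_ (by linarith))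
      (by positivity)
    refine max_le ((add_le_add_left (le_max_left _ _) _).trans (le_abs_self _)) (abs_nonneg _)
  refine hmono.trans (h.trans_eq ?_)
  have e : ∀ j, |max (x j) 0| = max (x j) 0 := fun j => abs_of_nonneg (le_max_right _ _)
  have e2 : ∀ j, max (x j) 0 ^ (p - 2) * max (x j) 0 = polyLink p x j := by
    intro j
    rcases (le_max_right (x j) 0).eq_or_lt with h | h
    · rw [polyLink, ← h, mul_zero, Real.zero_rpow (by linarith)]
    · rw [polyLink, ← Real.rpow_add_one h.ne']
      congr 1
      ring
  simp only [e, e2, polyGrad_eq_mul_polyLink hp, polyPotential, mul_assoc, Finset.mul_sum]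

/-- A vector of deviations from a weighted mean has a small `ℓ^p` norm. -/
theorem sum_abs_sub_mean_rpow_le {p U : ℝ} (hp : 2 < p) {v w : ι → ℝ} (hv : ∀ a, |v a| ≤ U)
    (hw : ∀ a, 0 ≤ w a) (hw1 : ∑ a, w a = 1) :
    ∑ a, |v a - ∑ b, w b * v b| ^ p ≤ ((Fintype.card ι : ℝ) - 1) * (2 * U) ^ p := by
  classical
  -- Jensen. After the sums are exchanged, the diagonal term `a = b` vanishes, which gives the
  -- factor `n - 1` in place of `n`.
  have hconv : ∀ a, |v a - ∑ b, w b * v b| ^ p ≤ ∑ b, w b * |v a - v b| ^ p := by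
    intro a
    have h1 : |v a - ∑ b, w b * v b| ≤ ∑ b, w b * |v a - v b| := by
      have : v a - ∑ b, w b * v b = ∑ b, w b * (v a - v b) := by
        simp only [mul_sub, Finset.sum_sub_distrib, ← Finset.sum_mul, hw1, one_mul]
      rw [this]
      refine (Finset.abs_sum_le_sum_abs _ _).trans_eq (Finset.sum_congr rfl fun b _ => ?_)
      rw [abs_mul, abs_of_nonneg (hw b)]
    refine (Real.rpow_le_rpow (abs_nonneg _) h1 (by linarith)).trans ?_
    exact Real.rpow_arith_mean_le_arith_mean_rpow _ _ _ (fun b _ => hw b) hw1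
      (fun b _ => abs_nonneg _) (by linarith)
  refine (Finset.sum_le_sum fun a _ => hconv a).trans ?_
  rw [Finset.sum_comm]
  have hb : ∀ b, ∑ a, w b * |v a - v b| ^ p ≤
      w b * (((Fintype.card ι : ℝ) - 1) * (2 * U) ^ p) := by
    intro b
    rw [← Finset.mul_sum]
    refine mul_le_mul_of_nonneg_left ?_ (hw b)
    rw [← Finset.add_sum_erase _ _ (Finset.mem_univ b), sub_self, abs_zero,
      Real.zero_rpow (by linarith), zero_add]
    have hcard : (((Finset.univ.erase b).card : ℕ) : ℝ) = (Fintype.card ι : ℝ) - 1 := by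
      rw [Finset.card_erase_of_mem (Finset.mem_univ b), Finset.card_univ,
        Nat.cast_pred (Fintype.card_pos_iff.2 ⟨b⟩)]
    rw [← hcard, ← nsmul_eq_mul]
    refine Finset.sum_le_card_nsmul _ _ _ fun a _ =>
      Real.rpow_le_rpow (abs_nonneg _) ?_ (by linarith)
    have := abs_sub (v a) (v b)
    linarith [hv a, hv b]
  refine (Finset.sum_le_sum fun b _ => hb b).trans_eq ?_
  rw [← Finset.sum_mul, hw1, one_mul]

theorem abs_sub_mean_le {U : ℝ} {v w : ι → ℝ} (hv : ∀ a, |v a| ≤ U)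
    (hw : ∀ a, 0 ≤ w a) (hw1 : ∑ a, w a = 1) (a : ι) : |v a - ∑ b, w b * v b| ≤ 2 * U := by
  have h : |∑ b, w b * v b| ≤ U := by
    refine (Finset.abs_sum_le_sum_abs _ _).trans ?_
    calc ∑ b, |w b * v b| ≤ ∑ b, w b * U := Finset.sum_le_sum fun b _ => by
          rw [abs_mul, abs_of_nonneg (hw b)]
          exact mul_le_mul_of_nonneg_left (hv b) (hw b)
      _ = U := by rw [← Finset.sum_mul, hw1, one_mul]
  have := abs_sub (v a) (∑ b, w b * v b)
  linarith [hv a]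

/-- The policies proportional to `polyLink p x` satisfy the Blackwell condition for
`polyGrad p x`. -/
theorem sum_polyGrad_mul_sub_mean {p : ℝ} (hp : 2 < p) {x v w : ι → ℝ} (hw1 : ∑ a, w a = 1)
    (hw : polyLink p x ≠ 0 → ∀ a, w a = polyLink p x a / ∑ b, polyLink p x b) :
    ∑ a, polyGrad p x a * (v a - ∑ b, w b * v b) = 0 := by
  -- Where the link vanishes so does the gradient, and the arbitrary policy does no harm.
  by_cases h : polyLink p x = 0
  · simp [polyGrad_eq_mul_polyLink hp, h]
  · have hnn : ∀ a, 0 ≤ polyLink p x a := fun a => Real.rpow_nonneg (le_max_right _ _) _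
    have hS : ∑ b, polyLink p x b ≠ 0 := by
      intro h0
      refine h (funext fun a => ?_)
      exact (Finset.sum_eq_zero_iff_of_nonneg fun a _ => hnn a).1 h0 a (Finset.mem_univ a)
    have hl : ∀ a, polyGrad p x a =
        2 * (∑ l, (max (x l) 0) ^ p) ^ (2 / p - 1) * (∑ b, polyLink p x b) * w a := by
      intro a
      rw [polyGrad_eq_mul_polyLink hp, hw h a]
      field_simp
    simp only [hl, mul_assoc, ← Finset.mul_sum]
    simp only [mul_sub, Finset.sum_sub_distrib, ← Finset.sum_mul, hw1, one_mul, sub_self, mul_zero]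

/-- Approximate regret matching: the cumulative regret when the policies are proportional to
`polyLink p` of the estimates `x k`. -/
theorem polyPotential_regret_le {p U : ℝ} (hp : 2 < p) {v w x R : ℕ → ι → ℝ}
    (hv : ∀ k a, |v k a| ≤ U) (hw : ∀ k a, 0 ≤ w k a) (hw1 : ∀ k, ∑ a, w k a = 1)
    (hx : ∀ k, polyLink p (x k) ≠ 0 →
      ∀ a, w k a = polyLink p (x k) a / ∑ b, polyLink p (x k) b)
    (hR0 : R 0 = 0) (hR : ∀ k a, R (k + 1) a = R k a + (v k a - ∑ b, w k b * v k b)) (t : ℕ) :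
    polyPotential p (R t) ≤
      t * (p - 1) * 4 * U ^ 2 * ((Fintype.card ι : ℝ) - 1) ^ (2 / p) +
        2 * U * ∑ k ∈ Finset.range t, ∑ a, |polyGrad p (R k) a - polyGrad p (x k) a| := by
  have hι : Nonempty ι := by
    by_contra h
    rw [not_nonempty_iff] at h
    simpa using hw1 0
  have hU : 0 ≤ U := (abs_nonneg _).trans (hv 0 hι.some)
  have hn : 0 ≤ (Fintype.card ι : ℝ) - 1 := by
    have : (1 : ℝ) ≤ Fintype.card ι := by exact_mod_cast Fintype.card_pos
    linarith
  induction t with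
  | zero => simp [hR0, polyPotential, Real.zero_rpow (by linarith : p ≠ 0),
      Real.zero_rpow (by positivity : 2 / p ≠ 0)]
  | succ k ih =>
    set r : ι → ℝ := fun a => v k a - ∑ b, w k b * v k b with hr
    have h1 := polyPotential_add_le hp (R k) r
    rw [← show R (k + 1) = R k + r from funext fun a => hR k a] at h1
    -- The gradient at the estimate is orthogonal to `r`, so subtracting it is free and only the
    -- estimation error remains.
    have h2 : ∑ a, polyGrad p (R k) a * r a ≤
        2 * U * ∑ a, |polyGrad p (R k) a - polyGrad p (x k) a| := by
      have h0 := sum_polyGrad_mul_sub_mean (v := v k) hp (hw1 k) (hx k)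
      calc ∑ a, polyGrad p (R k) a * r a
          = ∑ a, (polyGrad p (R k) a - polyGrad p (x k) a) * r a := by
            simp only [sub_mul, Finset.sum_sub_distrib]
            rw [h0, sub_zero]
        _ ≤ ∑ a, 2 * U * |polyGrad p (R k) a - polyGrad p (x k) a| := by
            refine Finset.sum_le_sum fun a _ => (le_abs_self _).trans ?_
            rw [abs_mul, mul_comm]
            exact mul_le_mul_of_nonneg_right (abs_sub_mean_le (hv k) (hw k) (hw1 k) a)
              (abs_nonneg _)
        _ = _ := by rw [Finset.mul_sum]
    have h3 : (∑ a, |r a| ^ p) ^ (2 / p) ≤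
        4 * U ^ 2 * ((Fintype.card ι : ℝ) - 1) ^ (2 / p) := by
      refine (Real.rpow_le_rpow (by positivity)
        (sum_abs_sub_mean_rpow_le hp (hv k) (hw k) (hw1 k)) (by positivity)).trans_eq ?_
      rw [Real.mul_rpow hn (by positivity), ← Real.rpow_mul (by positivity),
        mul_div_cancel₀ _ (by linarith : p ≠ 0), Real.rpow_two]
      ring
    have h4 := mul_le_mul_of_nonneg_left h3 (by linarith : 0 ≤ p - 1)
    rw [Finset.sum_range_succ]
    push_cast
    linarith

/-- The `ℓ^p` norm dominates each coordinate. -/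
theorem max_zero_le_sqrt_polyPotential {p : ℝ} (hp : 2 < p) (x : ι → ℝ) (a : ι) :
    max (x a) 0 ≤ √(polyPotential p x) := by
  refine Real.le_sqrt_of_sq_le ?_
  have h1 : max (x a) 0 ^ p ≤ ∑ l, (max (x l) 0) ^ p :=
    Finset.single_le_sum (f := fun l => (max (x l) 0) ^ p)
      (fun l _ => Real.rpow_nonneg (le_max_right _ _) _) (Finset.mem_univ a)
  have h2 := Real.rpow_le_rpow (Real.rpow_nonneg (le_max_right _ _) _) h1
    (by positivity : 0 ≤ 2 / p)
  rwa [← Real.rpow_mul (le_max_right _ _), mul_div_cancel₀ _ (by linarith : p ≠ 0),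
    Real.rpow_two] at h2

end RegretMatching

/-! ### Histories, information states and perfect recall -/

section HistorySteps

variable {α : Type*}

theorem historySteps_cons (x : α) (l : List α) :
    historySteps (x :: l) = ([], x) :: (historySteps l).map fun q => (x :: q.1, q.2) := by
  simp [historySteps, List.zip_map_left, Prod.map]

theorem historySteps_append (h l : List α) :
    historySteps (h ++ l) = historySteps h ++ (historySteps l).map fun q => (h ++ q.1, q.2) := by
  induction h with
  | nil => simp [historySteps]
  | cons x h ih =>
    simp only [List.cons_append, historySteps_cons, ih, List.map_append, List.map_map]
    rfl

theorem historySteps_concat (h : List α) (a : α) :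
    historySteps (h ++ [a]) = historySteps h ++ [(h, a)] := by
  rw [historySteps_append]
  simp [historySteps]

theorem length_historySteps (h : List α) : (historySteps h).length = h.length := by
  simp [historySteps]

theorem drop_historySteps_append (h l : List α) :
    (historySteps (h ++ l)).drop h.length =
      (historySteps l).map fun q => (h ++ q.1, q.2) := by
  rw [historySteps_append, ← length_historySteps h, List.drop_left]

theorem mem_historySteps {z h : List α} {a : α} :
    (h, a) ∈ historySteps z ↔ h ++ [a] <+: z := by
  induction z using List.reverseRecOn with
  | nil => simp [historySteps]
  | append_singleton z b ih =>
    rw [historySteps_concat, List.mem_append, ih, List.prefix_concat_iff]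
    simp [or_comm]

end HistorySteps

namespace GameTree

variable {α : Type*} [DecidableEq α] [Fintype α] (T : GameTree α)

theorem mem_actionsAt {h : List α} {a : α} : a ∈ T.actionsAt h ↔ h ++ [a] ∈ T.hist := by
  simp [actionsAt]

theorem mem_hist_of_prefix {h z : List α} (hz : z ∈ T.hist) (hp : h <+: z) : h ∈ T.hist := by
  obtain ⟨l, rfl⟩ := hp
  induction l using List.reverseRecOn with
  | nil => simpa using hz
  | append_singleton l a ih => exact ih (T.prefix_mem _ a (by simpa using hz))

theorem mem_playerHist_of_concat {i : Fin 2} {h : List α} {a : α} (hz : h ++ [a] ∈ T.hist)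
    (hi : T.player h = some i) : h ∈ T.playerHist i := by
  rw [playerHist, Finset.mem_filter]
  exact ⟨T.prefix_mem _ _ hz, Finset.ne_empty_of_mem (T.mem_actionsAt.2 hz), hi⟩

end GameTree

namespace ZeroSumEFG

variable {α : Type*} [DecidableEq α] [Fintype α] (G : ZeroSumEFG α)

theorem part_mem_infoStates {i : Fin 2} {h : List α} (hh : h ∈ G.playerHist i) :
    (G.infoPartition i).part h ∈ G.infoStates i :=
  (G.infoPartition i).part_mem.2 hh

theorem mem_playerHist_of_mem {i : Fin 2} {s : Finset (List α)} (hs : s ∈ G.infoStates i)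
    {h : List α} (hh : h ∈ s) : h ∈ G.playerHist i :=
  (G.infoPartition i).le hs hh

theorem part_eq {i : Fin 2} {s : Finset (List α)} (hs : s ∈ G.infoStates i)
    {h : List α} (hh : h ∈ s) : (G.infoPartition i).part h = s :=
  (G.infoPartition i).part_eq_of_mem hs hh

theorem nonempty_of_mem_infoStates {i : Fin 2} {s : Finset (List α)} (hs : s ∈ G.infoStates i) :
    s.Nonempty :=
  (G.infoPartition i).nonempty_of_mem_parts hs

theorem actions_eq {i : Fin 2} {s : Finset (List α)} (hs : s ∈ G.infoStates i)
    {h : List α} (hh : h ∈ s) : G.actions s = G.actionsAt h := by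
  ext a
  rw [actions, Finset.mem_biUnion]
  exact ⟨fun ⟨h', hh', ha⟩ => G.same_actions i s hs h' hh' h hh ▸ ha, fun ha => ⟨h, hh, ha⟩⟩

theorem actions_part {i : Fin 2} {h : List α} (hh : h ∈ G.playerHist i) :
    G.actions ((G.infoPartition i).part h) = G.actionsAt h :=
  G.actions_eq (G.part_mem_infoStates hh) ((G.infoPartition i).mem_part hh)

theorem player_of_mem_playerHist {i : Fin 2} {h : List α} (hh : h ∈ G.playerHist i) :
    G.player h = some i :=
  (Finset.mem_filter.1 hh).2.2

/-- The steps of player `i` along the history `h`. -/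
def ownSteps (i : Fin 2) (h : List α) : List (List α × α) :=
  (historySteps h).filter fun q => G.player q.1 = some i

theorem ownSteps_concat (i : Fin 2) (h : List α) (a : α) :
    G.ownSteps i (h ++ [a]) =
      if G.player h = some i then G.ownSteps i h ++ [(h, a)] else G.ownSteps i h := by
  unfold ownSteps
  rw [historySteps_concat, List.filter_append]
  split_ifs with hi <;> simp [hi]

theorem mem_ownSteps {i : Fin 2} {z h : List α} {a : α} :
    (h, a) ∈ G.ownSteps i z ↔ h ++ [a] <+: z ∧ G.player h = some i := by
  simp [ownSteps, mem_historySteps]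

theorem ownSteps_prefix {i : Fin 2} {h z : List α} (hp : h <+: z) :
    G.ownSteps i h <+: G.ownSteps i z := by
  obtain ⟨l, rfl⟩ := hp
  exact ⟨_, by rw [ownSteps, ownSteps, historySteps_append, List.filter_append]⟩

theorem map_ownSteps_eq {i : Fin 2} {s : Finset (List α)} (hs : s ∈ G.infoStates i)
    {h h' : List α} (hh : h ∈ s) (hh' : h' ∈ s) :
    (G.ownSteps i h).map (fun q => ((G.infoPartition i).part q.1, q.2)) =
      (G.ownSteps i h').map (fun q => ((G.infoPartition i).part q.1, q.2)) :=
  G.perfect_recall i s hs h hh h' hh'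

/-- No history of an information state is a proper prefix of another one. -/
theorem not_concat_prefix {i : Fin 2} {s : Finset (List α)} (hs : s ∈ G.infoStates i)
    {h h' : List α} (hh : h ∈ s) (hh' : h' ∈ s) (a : α) : ¬ h ++ [a] <+: h' := by
  intro hp
  -- The step at `h` is one more own step on the way to `h'`, but perfect recall makes the two own
  -- sequences equally long.
  have h1 := (G.ownSteps_prefix (i := i) hp).length_le
  have h2 := congrArg List.length (G.map_ownSteps_eq hs hh hh')
  rw [ownSteps_concat, if_pos (G.player_of_mem_playerHist (G.mem_playerHist_of_mem hs hh))] at h1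
  simp only [List.length_map, List.length_append, List.length_singleton] at h1 h2
  omega

/-- A player meets distinct information states along a history. -/
theorem nodup_map_part_ownSteps (i : Fin 2) {z : List α} (hz : z ∈ G.hist) :
    ((G.ownSteps i z).map fun q => (G.infoPartition i).part q.1).Nodup := by
  induction z using List.reverseRecOn with
  | nil => simp [ownSteps, historySteps]
  | append_singleton z b ih =>
    rw [ownSteps_concat]
    have hz' := G.prefix_mem _ _ hz
    split_ifs with hi
    · have hzi := G.mem_playerHist_of_concat hz hi
      rw [List.map_append, List.nodup_append]
      refine ⟨ih hz', by simp, ?_⟩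
      simp only [List.map_cons, List.map_nil, List.mem_singleton, List.mem_map, forall_eq]
      rintro _ ⟨⟨h, a⟩, hq, rfl⟩ heq
      rw [mem_ownSteps] at hq
      have hh := G.mem_playerHist_of_concat (G.mem_hist_of_prefix hz' hq.1) hq.2
      -- A repeated state would contain both `z` and a proper prefix of `z`.
      refine G.not_concat_prefix (G.part_mem_infoStates hzi) ?_
        ((G.infoPartition i).mem_part hzi) a hq.1
      rw [← heq]
      exact (G.infoPartition i).mem_part hh
    · exact ih hz'

theorem stepProb_of_player (σ : G.Profile) {i : Fin 2} {h : List α} (hi : G.player h = some i)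
    (a : α) : G.stepProb σ h a = (σ i).prob ((G.infoPartition i).part h) a := by
  simp [stepProb, hi]

theorem stepProb_nonneg (σ : G.Profile) {h : List α} {a : α} (ha : h ++ [a] ∈ G.hist) :
    0 ≤ G.stepProb σ h a := by
  have ha' := G.mem_actionsAt.2 ha
  rcases hp : G.player h with _ | i
  · simp only [stepProb, hp]
    exact G.chance_nonneg h (G.prefix_mem _ _ ha) (Finset.ne_empty_of_mem ha') hp a ha'
  · rw [stepProb_of_player G σ hp]
    have hh := G.mem_playerHist_of_concat ha hp
    exact (σ i).nonneg _ (G.part_mem_infoStates hh) a (by rwa [G.actions_part hh])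

theorem sum_stepProb (σ : G.Profile) {h : List α} (hh : h ∈ G.hist) (hne : G.actionsAt h ≠ ∅) :
    ∑ a ∈ G.actionsAt h, G.stepProb σ h a = 1 := by
  rcases hp : G.player h with _ | i
  · simp only [stepProb, hp]
    exact G.chance_sum h hh hne hp
  · have hi : h ∈ G.playerHist i := Finset.mem_filter.2 ⟨hh, hne, hp⟩
    simp only [stepProb_of_player G σ hp]
    rw [← G.actions_part hi]
    exact (σ i).sum_eq_one _ (G.part_mem_infoStates hi)

/-! ### Reach probabilities and the regret decomposition -/

theorem reach_self (σ : G.Profile) (C : Finset (Option (Fin 2))) (h : List α) :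
    G.reach σ C h h = 1 := by
  simp [reach, ← length_historySteps h]

theorem reach_eq_zero (σ : G.Profile) (C : Finset (Option (Fin 2))) {h z : List α}
    (hp : ¬ h <+: z) : G.reach σ C h z = 0 :=
  if_neg hp

theorem reach_append (σ : G.Profile) (C : Finset (Option (Fin 2))) (h l : List α) :
    G.reach σ C h (h ++ l) = ((((historySteps l).map fun q => (h ++ q.1, q.2)).filter
      fun q => G.player q.1 ∈ C).map fun q => G.stepProb σ q.1 q.2).prod := by
  rw [reach, if_pos (List.prefix_append _ _), drop_historySteps_append]

theorem reach_concat (σ : G.Profile) (C : Finset (Option (Fin 2))) {h z : List α} (hp : h <+: z)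
    (b : α) : G.reach σ C h (z ++ [b]) =
      G.reach σ C h z * if G.player z ∈ C then G.stepProb σ z b else 1 := by
  obtain ⟨l, rfl⟩ := hp
  rw [List.append_assoc, reach_append, reach_append, historySteps_concat, List.map_append,
    List.filter_append, List.map_append, List.prod_append]
  congr 1
  split_ifs with hC <;> simp [hC]

theorem reach_nil_concat (σ : G.Profile) (C : Finset (Option (Fin 2))) (z : List α) (b : α) :
    G.reach σ C [] (z ++ [b]) =
      G.reach σ C [] z * if G.player z ∈ C then G.stepProb σ z b else 1 :=
  G.reach_concat σ C List.nil_prefix b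

theorem reach_congr {σ σ' : G.Profile} {C : Finset (Option (Fin 2))}
    (H : ∀ h a, G.player h ∈ C → G.stepProb σ h a = G.stepProb σ' h a) (h z : List α) :
    G.reach σ C h z = G.reach σ' C h z := by
  unfold reach
  congr 2
  refine List.map_congr_left fun q hq => ?_
  rw [List.mem_filter] at hq
  exact H _ _ (by simpa using hq.2)

theorem reach_univ (σ : G.Profile) (C : Finset (Option (Fin 2))) (z : List α) :
    G.reach σ Finset.univ [] z = G.reach σ C [] z * G.reach σ Cᶜ [] z := by
  induction z using List.reverseRecOn with
  | nil => simp [reach_self]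
  | append_singleton z b ih =>
    rw [reach_nil_concat, reach_nil_concat, reach_nil_concat, ih]
    by_cases hC : G.player z ∈ C <;> simp [hC] <;> ring

theorem reach_nonneg (σ : G.Profile) (C : Finset (Option (Fin 2))) {h z : List α}
    (hz : z ∈ G.hist) : 0 ≤ G.reach σ C h z := by
  by_cases hp : h <+: z
  · obtain ⟨l, rfl⟩ := hp
    induction l using List.reverseRecOn with
    | nil => simp [reach_self]
    | append_singleton l b ih =>
      rw [← List.append_assoc] at hz ⊢
      rw [reach_concat _ _ _ (List.prefix_append _ _)]
      refine mul_nonneg (ih (G.prefix_mem _ _ hz)) ?_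
      split_ifs
      · exact G.stepProb_nonneg σ hz
      · exact zero_le_one
  · rw [reach_eq_zero _ _ _ hp]

/-- The contribution of the policy `τ` of player `i` to the probability of reaching `h`. -/
def ownReach {i : Fin 2} (τ : G.Strategy i) (h : List α) : ℝ :=
  ((G.ownSteps i h).map fun q => τ.prob ((G.infoPartition i).part q.1) q.2).prod

theorem reach_own (σ : G.Profile) (i : Fin 2) (h : List α) :
    G.reach σ {some i} [] h = G.ownReach (σ i) h := by
  induction h using List.reverseRecOn with
  | nil => simp [reach_self, ownReach, ownSteps, historySteps]
  | append_singleton h a ih =>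
    rw [reach_nil_concat, ih, ownReach, ownReach, ownSteps_concat]
    by_cases hi : G.player h = some i
    · simp [hi, stepProb_of_player G σ hi]
    · simp [hi]

theorem ownReach_concat {i : Fin 2} (τ : G.Strategy i) (h : List α) (a : α) :
    G.ownReach τ (h ++ [a]) = G.ownReach τ h *
      if G.player h = some i then τ.prob ((G.infoPartition i).part h) a else 1 := by
  rw [ownReach, ownReach, ownSteps_concat]
  split_ifs <;> simp

/-- The product depends only on the sequence of own states and actions, which perfect recall fixes
on `s`. -/
theorem ownReach_eq {i : Fin 2} (τ : G.Strategy i) {s : Finset (List α)}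
    (hs : s ∈ G.infoStates i) {h h' : List α} (hh : h ∈ s) (hh' : h' ∈ s) :
    G.ownReach τ h = G.ownReach τ h' := by
  have := congrArg (fun l => (l.map fun q : Finset (List α) × α => τ.prob q.1 q.2).prod)
    (G.map_ownSteps_eq hs hh hh')
  simpa [List.map_map, Function.comp_def, ownReach] using this

theorem reach_update_compl (σ : G.Profile) (i : Fin 2) (τ : G.Strategy i) (h z : List α) :
    G.reach (Function.update σ i τ) {some i}ᶜ h z = G.reach σ {some i}ᶜ h z := by
  refine G.reach_congr (fun h a hC => ?_) h z
  rcases hp : G.player h with _ | j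
  · simp [stepProb, hp]
  · have hj : j ≠ i := by simpa [hp] using hC
    rw [stepProb_of_player G _ hp, stepProb_of_player G _ hp, Function.update_of_ne hj]

/-- The player `j` factored out need not be `i`: `j = i` serves deviations, `j ≠ i` the averaging of
the opponent. -/
theorem value_eq (i j : Fin 2) (σ : G.Profile) :
    G.value i σ = ∑ z ∈ G.terminals,
      G.ownReach (σ j) z * G.reach σ {some j}ᶜ [] z * G.payoff i z := by
  refine Finset.sum_congr rfl fun z _ => ?_
  rw [G.reach_univ σ {some j}, reach_own]

theorem value_update_eq (i : Fin 2) (σ : G.Profile) (τ : G.Strategy i) :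
    G.value i (Function.update σ i τ) = ∑ z ∈ G.terminals,
      G.ownReach τ z * G.reach σ {some i}ᶜ [] z * G.payoff i z := by
  rw [G.value_eq i i]
  simp only [Function.update_self, reach_update_compl]

theorem ownReach_nonneg {i : Fin 2} (τ : G.Strategy i) {h : List α} (hh : h ∈ G.hist) :
    0 ≤ G.ownReach τ h := by
  induction h using List.reverseRecOn with
  | nil => simp [ownReach, ownSteps, historySteps]
  | append_singleton h a ih =>
    rw [ownReach_concat]
    refine mul_nonneg (ih (G.prefix_mem _ _ hh)) ?_
    split_ifs with hi
    · have hm := G.mem_playerHist_of_concat hh hi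
      exact τ.nonneg _ (G.part_mem_infoStates hm) a
        (by rw [G.actions_part hm]; exact G.mem_actionsAt.2 hh)
    · exact zero_le_one

theorem prob_le_one {i : Fin 2} (τ : G.Strategy i) {s : Finset (List α)}
    (hs : s ∈ G.infoStates i) {a : α} (ha : a ∈ G.actions s) : τ.prob s a ≤ 1 := by
  rw [← τ.sum_eq_one s hs]
  exact Finset.single_le_sum (τ.nonneg s hs) ha

theorem ownReach_le_one {i : Fin 2} (τ : G.Strategy i) {h : List α} (hh : h ∈ G.hist) :
    G.ownReach τ h ≤ 1 := by
  induction h using List.reverseRecOn with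
  | nil => simp [ownReach, ownSteps, historySteps]
  | append_singleton h a ih =>
    rw [ownReach_concat]
    have hh' := G.prefix_mem _ _ hh
    split_ifs with hi
    · have hm := G.mem_playerHist_of_concat hh hi
      have ha : a ∈ G.actions ((G.infoPartition i).part h) := by
        rw [G.actions_part hm]; exact G.mem_actionsAt.2 hh
      exact mul_le_one₀ (ih hh') (τ.nonneg _ (G.part_mem_infoStates hm) a ha)
        (G.prob_le_one τ (G.part_mem_infoStates hm) ha)
    · rw [mul_one]
      exact ih hh'

/-- The last summand is the jump from `0` to `1` when the endpoint first equals the starting point.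
It produces the new term in the induction for `ownReach_sub`. -/
theorem reach_concat_concat (σ : G.Profile) (C : Finset (Option (Fin 2))) (h z : List α) (a b : α) :
    G.reach σ C (h ++ [a]) (z ++ [b]) =
      (G.reach σ C (h ++ [a]) z * if G.player z ∈ C then G.stepProb σ z b else 1) +
        if h = z then (if a = b then 1 else 0) else 0 := by
  by_cases hp : h ++ [a] <+: z
  · have hne : h ≠ z := by
      rintro rfl
      simpa using hp.length_le
    rw [G.reach_concat σ C hp, if_neg hne, add_zero]
  · rw [G.reach_eq_zero σ C hp, zero_mul, zero_add]
    by_cases he : h ++ [a] = z ++ [b]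
    · rw [he, reach_self]
      have := List.append_inj' he rfl
      simp_all
    · rw [reach_eq_zero _ _ _ (by rw [List.prefix_concat_iff]; tauto)]
      split_ifs with h1 h2 <;> simp_all

/-- A telescoping difference of products: `τ` is used before `h`, the two policies are compared at
`h`, and `σ i` is used afterwards. -/
theorem ownReach_sub (σ : G.Profile) {i : Fin 2} (τ : G.Strategy i) {z : List α}
    (hz : z ∈ G.hist) :
    G.ownReach τ z - G.ownReach (σ i) z = ∑ h ∈ G.playerHist i, ∑ a ∈ G.actionsAt h,
      G.ownReach τ h * (τ.prob ((G.infoPartition i).part h) a -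
        (σ i).prob ((G.infoPartition i).part h) a) * G.reach σ {some i} (h ++ [a]) z := by
  induction z using List.reverseRecOn with
  | nil =>
    simp [ownReach, ownSteps, historySteps, reach]
  | append_singleton z b ih =>
    have hz' := G.prefix_mem _ _ hz
    have hb := G.mem_actionsAt.2 hz
    simp only [reach_concat_concat]
    generalize hc : (if G.player z ∈ ({some i} : Finset (Option (Fin 2))) then
      G.stepProb σ z b else 1) = c
    simp only [mul_add, Finset.sum_add_distrib, ← mul_assoc,
      ← Finset.sum_mul, ← ih hz', mul_ite, mul_one, mul_zero, ownReach_concat]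
    subst hc
    by_cases hi : G.player z = some i
    · have hm := G.mem_playerHist_of_concat hz hi
      have e : ∑ h ∈ G.playerHist i, ∑ a ∈ G.actionsAt h, (if h = z then if a = b then
          G.ownReach τ h * (τ.prob ((G.infoPartition i).part h) a -
            (σ i).prob ((G.infoPartition i).part h) a) else 0 else 0) =
          G.ownReach τ z * (τ.prob ((G.infoPartition i).part z) b -
            (σ i).prob ((G.infoPartition i).part z) b) := by
        rw [Finset.sum_eq_single_of_mem z hm (fun h _ hne => by simp [hne]),
          Finset.sum_eq_single_of_mem b hb (fun a _ hne => by simp [hne])]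
        simp
      rw [e]
      simp only [hi, Finset.mem_singleton, if_true, stepProb_of_player G σ hi]
      ring
    · have e : ∑ h ∈ G.playerHist i, ∑ a ∈ G.actionsAt h, (if h = z then if a = b then
          G.ownReach τ h * (τ.prob ((G.infoPartition i).part h) a -
            (σ i).prob ((G.infoPartition i).part h) a) else 0 else 0) = 0 := by
        refine Finset.sum_eq_zero fun h hh => Finset.sum_eq_zero fun a _ => ?_
        rw [if_neg]
        rintro rfl
        exact hi (G.player_of_mem_playerHist hh)
      rw [e]
      simp [hi]

/-- The contribution of the policy `τ` to the probability of reaching any history of `s`; by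
perfect recall the average below is over equal numbers. -/
noncomputable def infoReach {i : Fin 2} (τ : G.Strategy i) (s : Finset (List α)) : ℝ :=
  (∑ h ∈ s, G.ownReach τ h) / s.card

theorem infoReach_eq {i : Fin 2} (τ : G.Strategy i) {s : Finset (List α)}
    (hs : s ∈ G.infoStates i) {h : List α} (hh : h ∈ s) : G.infoReach τ s = G.ownReach τ h := by
  rw [infoReach, Finset.sum_congr rfl fun h' hh' => G.ownReach_eq τ hs hh' hh, Finset.sum_const,
    nsmul_eq_mul]
  have : (s.card : ℝ) ≠ 0 := by exact_mod_cast (Finset.card_pos.2 ⟨h, hh⟩).ne'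
  field_simp

/-- The sum over a player's histories, grouped by information states. -/
theorem sum_playerHist (i : Fin 2) (F : List α → ℝ) :
    ∑ h ∈ G.playerHist i, F h = ∑ s ∈ G.infoStates i, ∑ h ∈ s, F h := by
  conv_lhs => rw [← (G.infoPartition i).biUnion_parts]
  exact Finset.sum_biUnion (G.infoPartition i).supIndep.pairwiseDisjoint

theorem terminals_subset {z : List α} (hz : z ∈ G.terminals) : z ∈ G.hist :=
  (Finset.mem_filter.1 hz).1

/-- The counterfactual regret decomposition of the gain from a deviation. -/
theorem value_update_sub (σ : G.Profile) {i : Fin 2} (τ : G.Strategy i) :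
    G.value i (Function.update σ i τ) - G.value i σ = ∑ s ∈ G.infoStates i,
      G.infoReach τ s * ∑ a ∈ G.actions s, τ.prob s a * G.cfRegret i σ s a := by
  have h1 : G.value i (Function.update σ i τ) - G.value i σ =
      ∑ h ∈ G.playerHist i, ∑ a ∈ G.actionsAt h, G.ownReach τ h *
        (τ.prob ((G.infoPartition i).part h) a - (σ i).prob ((G.infoPartition i).part h) a) *
        ∑ z ∈ G.terminals, G.reach σ {some i} (h ++ [a]) z * G.reach σ {some i}ᶜ [] z *
          G.payoff i z := by
    rw [value_update_eq, G.value_eq i i σ, ← Finset.sum_sub_distrib]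
    simp only [Finset.mul_sum]
    rw [Finset.sum_congr rfl fun h _ => Finset.sum_comm, Finset.sum_comm]
    refine Finset.sum_congr rfl fun z hz => ?_
    rw [← sub_mul, ← sub_mul, G.ownReach_sub σ τ (G.terminals_subset hz)]
    simp only [Finset.sum_mul]
    exact Finset.sum_congr rfl fun h _ => Finset.sum_congr rfl fun a _ => by ring
  rw [h1, sum_playerHist]
  refine Finset.sum_congr rfl fun s hs => ?_
  have h2 : ∀ h ∈ s, ∑ a ∈ G.actionsAt h, G.ownReach τ h *
        (τ.prob ((G.infoPartition i).part h) a - (σ i).prob ((G.infoPartition i).part h) a) *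
        ∑ z ∈ G.terminals, G.reach σ {some i} (h ++ [a]) z * G.reach σ {some i}ᶜ [] z *
          G.payoff i z = ∑ a ∈ G.actions s, G.infoReach τ s * (τ.prob s a - (σ i).prob s a) *
        ∑ z ∈ G.terminals, G.reach σ {some i} (h ++ [a]) z * G.reach σ {some i}ᶜ [] z *
          G.payoff i z := by
    -- On `s` the own reach and the action probabilities are constant, so they leave the sum over
    -- `h`, and what remains is the counterfactual value.
    intro h hh
    rw [G.part_eq hs hh, G.actions_eq hs hh, G.infoReach_eq τ hs hh]
  rw [Finset.sum_congr rfl h2, Finset.sum_comm, Finset.mul_sum]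
  simp only [← Finset.mul_sum]
  change ∑ a ∈ G.actions s, G.infoReach τ s * (τ.prob s a - (σ i).prob s a) * G.cfValue i σ s a = _
  -- As `τ` has total mass one at `s`, `∑ (τ - σ) v = ∑ τ (v - ∑ σ v)`.
  simp only [cfRegret, mul_sub, sub_mul, Finset.sum_sub_distrib, ← Finset.mul_sum,
    ← Finset.sum_mul, τ.sum_eq_one s hs, one_mul, mul_assoc]

/-! ### Pure strategies and the policies that induce them -/

/-- Independence across states: the expectation of a product of indicators factors. Distinctness of
the states matters, as a repeated one would contribute its probability only once on the left. -/
theorem sum_pureProb_mul_prod {i : Fin 2} (τ : G.Strategy i)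
    {l : List (Finset (List α) × α)} (hl : ∀ q ∈ l, q.1 ∈ G.infoStates i ∧ q.2 ∈ G.actions q.1)
    (hn : (l.map Prod.fst).Nodup) :
    ∑ a : G.PureStrategy i, pureProb τ a * (l.map fun q => a.toStrategy.prob q.1 q.2).prod =
      (l.map fun q => τ.prob q.1 q.2).prod := by
  classical
  -- The product along the list is regrouped by information states; `marg` then computes the
  -- expectation at one state, where at most one entry is relevant.
  have split : ∀ (l : List (Finset (List α) × α)), (∀ q ∈ l, q.1 ∈ G.infoStates i) →
      ∀ F : (s : G.infoStates i) → α → ℝ,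
      ∏ s : G.infoStates i, (l.map fun q => if q.1 = s.1 then F s q.2 else 1).prod =
        (l.map fun q => if h : q.1 ∈ G.infoStates i then F ⟨q.1, h⟩ q.2 else 1).prod := by
    intro l hl F
    induction l with
    | nil => simp
    | cons q l ih =>
      have hq := hl q List.mem_cons_self
      simp only [List.map_cons, List.prod_cons, Finset.prod_mul_distrib,
        ih fun q hq => hl q (List.mem_cons_of_mem _ hq), dif_pos hq]
      congr 1
      rw [Finset.prod_eq_single_of_mem (⟨q.1, hq⟩ : G.infoStates i) (Finset.mem_univ _)]
      · simp
      · intro s _ hne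
        rw [if_neg]
        rintro h
        exact hne (Subtype.ext h.symm)
  have marg : ∀ (l : List (Finset (List α) × α)), (∀ q ∈ l, q.2 ∈ G.actions q.1) →
      (l.map Prod.fst).Nodup → ∀ s : G.infoStates i,
      ∑ b : G.actions s.1, τ.prob s.1 b *
        (l.map fun q => if q.1 = s.1 then (if (b : α) = q.2 then (1 : ℝ) else 0) else 1).prod =
      (l.map fun q => if q.1 = s.1 then τ.prob s.1 q.2 else 1).prod := by
    intro l hl hn s
    induction l with
    | nil =>
      simp only [List.map_nil, List.prod_nil, mul_one]
      rw [Finset.sum_coe_sort (G.actions s.1) fun b => τ.prob s.1 b]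
      exact τ.sum_eq_one _ s.2
    | cons q l ih =>
      rw [List.map_cons, List.nodup_cons] at hn
      by_cases hq : q.1 = s.1
      · have triv : ∀ F : Finset (List α) × α → ℝ,
            (l.map fun q => if q.1 = s.1 then F q else 1).prod = 1 := by
          intro F
          refine List.prod_eq_one fun x hx => ?_
          obtain ⟨r, hr, rfl⟩ := List.mem_map.1 hx
          rw [if_neg]
          intro h
          exact hn.1 (List.mem_map.2 ⟨r, hr, h.trans hq.symm⟩)
        have hmem : q.2 ∈ G.actions s.1 := hq ▸ hl q List.mem_cons_self
        simp only [List.map_cons, List.prod_cons, hq, if_true, triv, mul_one]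
        rw [Finset.sum_eq_single_of_mem (⟨q.2, hmem⟩ : G.actions s.1) (Finset.mem_univ _)]
        · simp
        · intro b _ hne
          rw [if_neg, mul_zero]
          exact fun h => hne (Subtype.ext h)
      · simp only [List.map_cons, List.prod_cons, hq, if_false, one_mul]
        exact ih (fun q hq => hl q (List.mem_cons_of_mem _ hq)) hn.2
  have hpure : ∀ a : G.PureStrategy i, (l.map fun q => a.toStrategy.prob q.1 q.2).prod =
      ∏ s : G.infoStates i, (l.map fun q => if q.1 = s.1 then
        (if (a s : α) = q.2 then (1 : ℝ) else 0) else 1).prod := by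
    intro a
    rw [split l (fun q hq => (hl q hq).1) fun s b => if (a s : α) = b then 1 else 0]
    refine congrArg List.prod (List.map_congr_left fun q hq => ?_)
    simp only [PureStrategy.toStrategy, dif_pos (hl q hq).1]
  have hbeh : (l.map fun q => τ.prob q.1 q.2).prod =
      ∏ s : G.infoStates i, (l.map fun q => if q.1 = s.1 then τ.prob s.1 q.2 else 1).prod := by
    rw [split l (fun q hq => (hl q hq).1) fun s b => τ.prob s.1 b]
    refine congrArg List.prod (List.map_congr_left fun q hq => ?_)
    simp only [dif_pos (hl q hq).1]
  simp only [hpure, hbeh, pureProb, ← Finset.prod_mul_distrib,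
    ← marg l (fun q hq => (hl q hq).2) hn]
  rw [Finset.prod_univ_sum, Fintype.piFinset_univ]

theorem sum_pureProb {i : Fin 2} (τ : G.Strategy i) :
    ∑ a : G.PureStrategy i, pureProb τ a = 1 := by
  simpa using G.sum_pureProb_mul_prod τ (l := []) (by simp) (by simp)

/-- The part of Kuhn's theorem that is needed; perfect recall enters through
`nodup_map_part_ownSteps`. -/
theorem sum_pureProb_mul_ownReach {i : Fin 2} (τ : G.Strategy i) {z : List α} (hz : z ∈ G.hist) :
    ∑ a : G.PureStrategy i, pureProb τ a * G.ownReach a.toStrategy z = G.ownReach τ z := by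
  have := G.sum_pureProb_mul_prod τ
    (l := (G.ownSteps i z).map fun q => ((G.infoPartition i).part q.1, q.2)) ?_ ?_
  · simpa only [List.map_map, Function.comp_def, ownReach] using this
  · simp only [List.mem_map]
    rintro _ ⟨⟨h, a⟩, hq, rfl⟩
    rw [mem_ownSteps] at hq
    have ha := G.mem_hist_of_prefix hz hq.1
    have hm := G.mem_playerHist_of_concat ha hq.2
    refine ⟨G.part_mem_infoStates hm, ?_⟩
    rw [G.actions_part hm]
    exact G.mem_actionsAt.2 ha
  · simpa only [List.map_map, Function.comp_def] using G.nodup_map_part_ownSteps i hz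

/-- The expected value of a random pure strategy is that of the policy which induces it. -/
theorem sum_pureProb_mul_value (i : Fin 2) (σ : G.Profile) :
    ∑ a : G.PureStrategy i, pureProb (σ i) a * G.value i (Function.update σ i a.toStrategy) =
      G.value i σ := by
  simp only [value_update_eq, Finset.mul_sum]
  rw [Finset.sum_comm, G.value_eq i i σ]
  refine Finset.sum_congr rfl fun z hz => ?_
  rw [← G.sum_pureProb_mul_ownReach (σ i) (G.terminals_subset hz)]
  simp only [Finset.sum_mul]
  exact Finset.sum_congr rfl fun a _ => by ring

theorem pureRegret_eq (i : Fin 2) (σ : G.Profile) (a : G.PureStrategy i) :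
    G.pureRegret i σ a = G.value i (Function.update σ i a.toStrategy) - G.value i σ := by
  simp only [pureRegret, mul_sub, Finset.sum_sub_distrib, ← Finset.sum_mul, sum_pureProb,
    sum_pureProb_mul_value, one_mul]

/-! ### Average policies and approximate equilibria -/

/-- At an own history the averaging weights are `s.card` times the own reach, which turns the
averaging rule into the induction step. Nothing is divided by the total weight, so states where it
vanishes need no separate case. -/
theorem IsAverage.mul_ownReach {G : ZeroSumEFG α} {σ : ℕ → G.Profile} {t : ℕ} {σbar : G.Profile}
    (hav : G.IsAverage σ t σbar) (i : Fin 2) {h : List α} (hh : h ∈ G.hist) :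
    t * G.ownReach (σbar i) h = ∑ k ∈ Finset.range t, G.ownReach (σ k i) h := by
  induction h using List.reverseRecOn with
  | nil => simp [ownReach, ownSteps, historySteps]
  | append_singleton h a ih =>
    simp only [ownReach_concat, ← mul_assoc, ih (G.prefix_mem _ _ hh)]
    split_ifs with hi
    · have hm := G.mem_playerHist_of_concat hh hi
      have hs := G.part_mem_infoStates hm
      have hmem := (G.infoPartition i).mem_part hm
      have := hav i _ hs a (by rw [G.actions_part hm]; exact G.mem_actionsAt.2 hh)
      have e : ∀ k, ∀ h' ∈ (G.infoPartition i).part h,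
          G.reach (σ k) {some i} [] h' = G.ownReach (σ k i) h := fun k h' hh' => by
        rw [reach_own, G.ownReach_eq _ hs hh' hmem]
      have e1 : ∀ k, ∑ h' ∈ (G.infoPartition i).part h, G.reach (σ k) {some i} [] h' =
          ((G.infoPartition i).part h).card * G.ownReach (σ k i) h := fun k => by
        rw [Finset.sum_congr rfl (e k), Finset.sum_const, nsmul_eq_mul]
      simp only [← Finset.sum_mul, e1, mul_assoc, ← Finset.mul_sum] at this
      exact mul_left_cancel₀
        (by exact_mod_cast (Finset.card_pos.2 ⟨h, hmem⟩).ne') this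
    · simp

/-- Against the average policy of the opponent, a policy earns its average value. -/
theorem IsAverage.mul_value {G : ZeroSumEFG α} {σ : ℕ → G.Profile} {t : ℕ} {σbar : G.Profile}
    (hav : G.IsAverage σ t σbar) {i : Fin 2} (τ : G.Strategy i) :
    t * G.value i (Function.update σbar i τ) =
      ∑ k ∈ Finset.range t, G.value i (Function.update (σ k) i τ) := by
  obtain ⟨j, hj⟩ : ∃ j : Fin 2, j ≠ i := exists_ne i
  -- Once `i` plays `τ`, only the moves of `j` vary with the round, and the value is linear in the
  -- own reach of `j`.
  have hreach : ∀ k z, G.reach (Function.update (σ k) i τ) {some j}ᶜ [] z =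
      G.reach (Function.update σbar i τ) {some j}ᶜ [] z := by
    intro k z
    refine G.reach_congr (fun h a hC => ?_) [] z
    rcases hp : G.player h with _ | j'
    · simp [stepProb, hp]
    · have hj' : j' ≠ j := by simpa [hp] using hC
      obtain rfl : j' = i := by omega
      simp [stepProb_of_player G _ hp]
  simp only [G.value_eq i j, hreach, Function.update_of_ne hj]
  rw [Finset.sum_comm, Finset.mul_sum]
  refine Finset.sum_congr rfl fun z hz => ?_
  rw [← Finset.sum_mul, ← Finset.sum_mul, ← hav.mul_ownReach j (G.terminals_subset hz)]
  ring

theorem value_add_value (σ : G.Profile) {i j : Fin 2} (hj : j ≠ i) :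
    G.value i σ + G.value j σ = 0 := by
  rw [value, value, ← Finset.sum_add_distrib]
  refine Finset.sum_eq_zero fun z _ => ?_
  have : G.payoff i z + G.payoff j z = 0 := by
    unfold payoff
    fin_cases i <;> fin_cases j <;> simp_all
  rw [← mul_add, this, mul_zero]

/-- If no player gains much on average by a fixed policy, the average policies are an approximate
equilibrium. -/
theorem IsAverage.isNash {G : ZeroSumEFG α} {σ : ℕ → G.Profile} {t : ℕ} {σbar : G.Profile}
    (hav : G.IsAverage σ t σbar) (ht : 0 < t) {ε : Fin 2 → ℝ}
    (hε : ∀ (i : Fin 2) (τ : G.Strategy i), ∑ k ∈ Finset.range t,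
      (G.value i (Function.update (σ k) i τ) - G.value i (σ k)) ≤ t * ε i) :
    G.IsNash (ε 0 + ε 1) σbar := by
  intro i τ
  obtain ⟨j, hj⟩ : ∃ j : Fin 2, j ≠ i := exists_ne i
  have hsum : ε 0 + ε 1 = ε i + ε j := by
    fin_cases i <;> fin_cases j <;> simp_all [add_comm]
  -- For the opponent the comparison policy is its own average, so that `σbar` itself appears. In
  -- the sum of both inequalities the played values cancel.
  have h1 := hε i τ
  have h2 := hε j (σbar j)
  rw [Finset.sum_sub_distrib, ← hav.mul_value] at h1 h2
  rw [Function.update_eq_self] at h2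
  have h3 : ∑ k ∈ Finset.range t, G.value i (σ k) + ∑ k ∈ Finset.range t, G.value j (σ k) = 0 := by
    rw [← Finset.sum_add_distrib]
    exact Finset.sum_eq_zero fun k _ => G.value_add_value (σ k) hj
  have h4 := G.value_add_value σbar hj
  have ht' : (0 : ℝ) < t := by exact_mod_cast ht
  rw [hsum]
  refine le_of_mul_le_mul_left ?_ ht'
  have h5 : G.value j σbar = - G.value i σbar := by linarith
  rw [h5] at h2
  linarith

end ZeroSumEFG

/-! ### Utility bounds imply bounds on counterfactual values -/

namespace GameTree

/-- The product of the weights `w` along the history `h`. -/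
def pathWeight {α : Type*} (w : List α → α → ℝ) (h : List α) : ℝ :=
  ((historySteps h).map fun q => w q.1 q.2).prod

theorem pathWeight_concat {α : Type*} (w : List α → α → ℝ) (h : List α) (a : α) :
    pathWeight w (h ++ [a]) = pathWeight w h * w h a := by
  simp [pathWeight, historySteps_concat]

variable {α : Type*} [DecidableEq α] [Fintype α] (T : GameTree α)

theorem pathWeight_nonneg {w : List α → α → ℝ}
    (hw : ∀ h a, h ++ [a] ∈ T.hist → 0 ≤ w h a) {h : List α} (hh : h ∈ T.hist) :
    0 ≤ pathWeight w h := by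
  induction h using List.reverseRecOn with
  | nil => simp [pathWeight, historySteps]
  | append_singleton h a ih =>
    rw [pathWeight_concat]
    exact mul_nonneg (ih (T.prefix_mem _ _ hh)) (hw h a hh)

/-- Substochastic weights at the histories give a subprobability on the terminal histories. -/
theorem sum_terminals_pathWeight_le_one {w : List α → α → ℝ}
    (hw : ∀ h a, h ++ [a] ∈ T.hist → 0 ≤ w h a)
    (hw1 : ∀ h ∈ T.hist, T.actionsAt h ≠ ∅ → ∑ a ∈ T.actionsAt h, w h a ≤ 1) :
    ∑ z ∈ T.terminals, pathWeight w z ≤ 1 := by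
  -- The mass alive at depth `n` plus the mass that ended earlier never increases with `n`. A depth
  -- beyond all histories gives the claim.
  have key : ∀ n : ℕ, ∑ h ∈ T.hist with h.length = n, pathWeight w h +
      ∑ z ∈ T.terminals with z.length < n, pathWeight w z ≤ 1 := by
    intro n
    induction n with
    | zero =>
      have : {h ∈ T.hist | h.length = 0} = {[]} := by
        ext h
        simp only [Finset.mem_filter, List.length_eq_zero_iff, Finset.mem_singleton,
          and_iff_right_iff_imp]
        rintro rfl
        exact T.nil_mem
      rw [this]
      simp [pathWeight, historySteps]
    | succ n ih =>
      have e1 : ∑ h ∈ T.hist with h.length = n + 1, pathWeight w h =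
          ∑ h ∈ T.hist with h.length = n, pathWeight w h * ∑ a ∈ T.actionsAt h, w h a := by
        simp only [Finset.mul_sum]
        rw [Finset.sum_sigma']
        symm
        refine Finset.sum_nbij (fun x => x.1 ++ [x.2]) ?_ ?_ ?_ ?_
        · rintro ⟨h, a⟩ hx
          simp only [Finset.mem_sigma, Finset.mem_filter, mem_actionsAt] at hx
          simp [hx.1.2, hx.2]
        · rintro ⟨h, a⟩ _ ⟨h', a'⟩ _ he
          have := List.append_inj' he rfl
          simp_all
        · intro g hg
          simp only [Finset.coe_filter, Set.mem_ofPred_eq] at hg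
          obtain ⟨hg, hlen⟩ := hg
          rcases List.eq_nil_or_concat g with rfl | ⟨h, a, rfl⟩
          · simp at hlen
          · rw [List.concat_eq_append] at hg hlen ⊢
            refine ⟨⟨h, a⟩, ?_, rfl⟩
            simp only [Finset.coe_sigma, Set.mem_sigma_iff, Finset.mem_coe, Finset.mem_filter,
              mem_actionsAt]
            exact ⟨⟨T.prefix_mem _ _ hg, by simpa using hlen⟩, hg⟩
        · rintro ⟨h, a⟩ _
          rw [pathWeight_concat]
      have e2 : ∑ z ∈ T.terminals with z.length < n + 1, pathWeight w z =
          ∑ z ∈ T.terminals with z.length < n, pathWeight w z +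
          ∑ h ∈ T.hist with h.length = n, if T.actionsAt h = ∅ then pathWeight w h else 0 := by
        rw [← Finset.sum_filter, Finset.filter_filter, terminals, Finset.filter_filter,
          Finset.filter_filter, ← Finset.sum_union]
        · congr 1
          ext h
          simp only [Finset.mem_filter, Finset.mem_union, Nat.lt_succ_iff_lt_or_eq]
          tauto
        · rw [Finset.disjoint_filter]
          rintro h _ h1 h2
          omega
      have e3 : ∑ h ∈ T.hist with h.length = n, pathWeight w h * ∑ a ∈ T.actionsAt h, w h a +
          ∑ h ∈ T.hist with h.length = n, (if T.actionsAt h = ∅ then pathWeight w h else 0) ≤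
          ∑ h ∈ T.hist with h.length = n, pathWeight w h := by
        rw [← Finset.sum_add_distrib]
        refine Finset.sum_le_sum fun h hh => ?_
        rw [Finset.mem_filter] at hh
        split_ifs with hA
        · simp [hA]
        · rw [add_zero]
          exact mul_le_of_le_one_right (T.pathWeight_nonneg hw hh.1) (hw1 h hh.1 hA)
      rw [e1, e2]
      linarith
  have hN : {z ∈ T.terminals | z.length < T.hist.sup List.length + 1} = T.terminals := by
    refine Finset.filter_true_of_mem fun z hz => Nat.lt_succ_of_le ?_
    exact Finset.le_sup (f := List.length) (Finset.mem_filter.1 hz).1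
  have h := key (T.hist.sup List.length + 1)
  rw [hN] at h
  have h0 : 0 ≤ ∑ h ∈ T.hist with h.length = T.hist.sup List.length + 1, pathWeight w h :=
    Finset.sum_nonneg fun h hh => T.pathWeight_nonneg hw (Finset.mem_filter.1 hh).1
  linarith

end GameTree

namespace ZeroSumEFG

variable {α : Type*} [DecidableEq α] [Fintype α] (G : ZeroSumEFG α)

/-- Perfect recall: the way to an information state determines the own actions on it. -/
theorem action_unique {i : Fin 2} {s : Finset (List α)} (hs : s ∈ G.infoStates i)
    {h h' g : List α} {a b b' : α} (hh : h ∈ s) (hh' : h' ∈ s) (hi : G.player g = some i)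
    (hb : g ++ [b] <+: h ++ [a]) (hb' : g ++ [b'] <+: h' ++ [a]) : b = b' := by
  have e : (G.ownSteps i (h ++ [a])).map (fun q => ((G.infoPartition i).part q.1, q.2)) =
      (G.ownSteps i (h' ++ [a])).map (fun q => ((G.infoPartition i).part q.1, q.2)) := by
    rw [ownSteps_concat, ownSteps_concat,
      if_pos (G.player_of_mem_playerHist (G.mem_playerHist_of_mem hs hh)),
      if_pos (G.player_of_mem_playerHist (G.mem_playerHist_of_mem hs hh')), List.map_append,
      List.map_append, G.map_ownSteps_eq hs hh hh']
    simp [G.part_eq hs hh, G.part_eq hs hh']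
  have p1 := (G.ownSteps_prefix (i := i) hb).map
    (fun q => ((G.infoPartition i).part q.1, q.2))
  have p2 := (G.ownSteps_prefix (i := i) hb').map
    (fun q => ((G.infoPartition i).part q.1, q.2))
  rw [← e] at p2
  rw [ownSteps_concat, if_pos hi] at p1 p2
  -- Two prefixes of one own sequence with equal length coincide, and so do their last actions.
  have := (List.prefix_of_prefix_length_le p1 p2 (by simp)).eq_of_length (by simp)
  simpa using this

open Classical in
/-- The transition weights under `σ` if player `i` steers toward the action `a` at the information
state `s`. -/
noncomputable def steeredProb (σ : G.Profile) (i : Fin 2) (s : Finset (List α)) (a : α)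
    (g : List α) (b : α) : ℝ :=
  if G.player g = some i ∧ ∃ h ∈ s, ∃ b', g ++ [b'] <+: h ++ [a] then
    (if ∃ h ∈ s, g ++ [b] <+: h ++ [a] then 1 else 0)
  else G.stepProb σ g b

theorem steeredProb_nonneg (σ : G.Profile) (i : Fin 2) (s : Finset (List α)) (a : α)
    {g : List α} {b : α} (hb : g ++ [b] ∈ G.hist) : 0 ≤ G.steeredProb σ i s a g b := by
  unfold steeredProb
  split_ifs
  · exact zero_le_one
  · exact le_rfl
  · exact G.stepProb_nonneg σ hb

/-- By `action_unique` at most one action is steered to. The sum can be `0`, as `a` need not be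
available at `s`. -/
theorem sum_steeredProb_le_one (σ : G.Profile) {i : Fin 2} {s : Finset (List α)}
    (hs : s ∈ G.infoStates i) (a : α) {g : List α} (hg : g ∈ G.hist) (hA : G.actionsAt g ≠ ∅) :
    ∑ b ∈ G.actionsAt g, G.steeredProb σ i s a g b ≤ 1 := by
  classical
  by_cases hc : G.player g = some i ∧ ∃ h ∈ s, ∃ b', g ++ [b'] <+: h ++ [a]
  · obtain ⟨hi, h, hh, b', hb'⟩ := hc
    calc ∑ b ∈ G.actionsAt g, G.steeredProb σ i s a g b
        ≤ ∑ b ∈ G.actionsAt g, if b' = b then 1 else 0 := by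
          refine Finset.sum_le_sum fun b _ => ?_
          rw [steeredProb, if_pos ⟨hi, h, hh, b', hb'⟩]
          split_ifs with h1 h2 h2
          · exact le_rfl
          · obtain ⟨h', hh', hb⟩ := h1
            exact absurd (G.action_unique hs hh hh' hi hb' hb) h2
          · exact zero_le_one
          · exact le_rfl
      _ ≤ 1 := by
          rw [Finset.sum_ite_eq]
          split_ifs <;> norm_num
  · simp only [steeredProb, if_neg hc]
    exact (G.sum_stepProb σ hg hA).le

/-- On the way to `s` the steering player contributes factors `1`, which leaves the opponent and
chance. -/
theorem pathWeight_steeredProb_of_prefix (σ : G.Profile) {i : Fin 2} {s : Finset (List α)}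
    {h : List α} (hh : h ∈ s) {a : α} {g : List α} (hg : g <+: h ++ [a]) :
    GameTree.pathWeight (G.steeredProb σ i s a) g = G.reach σ {some i}ᶜ [] g := by
  induction g using List.reverseRecOn with
  | nil => simp [GameTree.pathWeight, historySteps, reach_self]
  | append_singleton g b ih =>
    rw [GameTree.pathWeight_concat, reach_nil_concat, ih ((List.prefix_append _ _).trans hg)]
    congr 1
    by_cases hi : G.player g = some i
    · rw [steeredProb, if_pos ⟨hi, h, hh, b, hg⟩, if_pos ⟨h, hh, hg⟩]
      simp [hi]
    · rw [steeredProb, if_neg fun hc => hi hc.1]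
      simp [hi]

theorem pathWeight_steeredProb (σ : G.Profile) {i : Fin 2} {s : Finset (List α)}
    (hs : s ∈ G.infoStates i) {h : List α} (hh : h ∈ s) {a : α} {z : List α}
    (hz : h ++ [a] <+: z) :
    GameTree.pathWeight (G.steeredProb σ i s a) z =
      G.reach σ {some i} (h ++ [a]) z * G.reach σ {some i}ᶜ [] z := by
  obtain ⟨l, rfl⟩ := hz
  induction l using List.reverseRecOn with
  | nil =>
    rw [List.append_nil, reach_self, one_mul]
    exact G.pathWeight_steeredProb_of_prefix σ hh (List.prefix_refl _)
  | append_singleton l b ih =>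
    -- Steering ends after `h ++ [a]`, since no history of `s` extends it; from there `σ` applies.
    have hn : ¬ ∃ h' ∈ s, ∃ b', (h ++ [a] ++ l) ++ [b'] <+: h' ++ [a] := by
      rintro ⟨h', hh', b', hp⟩
      rw [List.prefix_concat_iff] at hp
      have hp' : h ++ [a] ++ l <+: h' := by
        rcases hp with he | hp
        · rw [(List.append_inj' he rfl).1]
        · exact (List.prefix_append _ _).trans hp
      exact G.not_concat_prefix hs hh hh' a ((List.prefix_append _ _).trans hp')
    rw [← List.append_assoc, GameTree.pathWeight_concat, ih, reach_nil_concat,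
      reach_concat _ _ _ (List.prefix_append _ _), steeredProb, if_neg fun hc => hn hc.2]
    by_cases hi : G.player (h ++ [a] ++ l) = some i
    · simp only [hi, Finset.mem_singleton, Finset.mem_compl, if_true, not_true, if_false]
      ring
    · simp only [hi, Finset.mem_singleton, Finset.mem_compl, if_false, not_false_iff, if_true]
      ring

/-- Each terminal history passes through at most one `h ∈ s`, so the inner sum over `s` is at most
its steered path weight. -/
theorem sum_reach_le_one (σ : G.Profile) {i : Fin 2} {s : Finset (List α)}
    (hs : s ∈ G.infoStates i) (a : α) :
    ∑ h ∈ s, ∑ z ∈ G.terminals,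
      G.reach σ {some i} (h ++ [a]) z * G.reach σ {some i}ᶜ [] z ≤ 1 := by
  rw [Finset.sum_comm]
  refine le_trans (Finset.sum_le_sum fun z hz => ?_)
    (G.sum_terminals_pathWeight_le_one (w := G.steeredProb σ i s a)
      (fun g b hb => G.steeredProb_nonneg σ i s a hb)
      fun g hg hA => G.sum_steeredProb_le_one σ hs a hg hA)
  by_cases hex : ∃ h ∈ s, h ++ [a] <+: z
  · obtain ⟨h, hh, hp⟩ := hex
    rw [Finset.sum_eq_single_of_mem h hh, G.pathWeight_steeredProb σ hs hh hp]
    intro h' hh' hne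
    rw [reach_eq_zero, zero_mul]
    intro hp'
    have incomparable : ∀ g ∈ s, ∀ g' ∈ s, g' ≠ g → ¬ g <+: g' := by
      rintro g hg g' hg' hne ⟨l, rfl⟩
      rcases l with _ | ⟨b, l⟩
      · simp at hne
      · exact G.not_concat_prefix hs hg hg' b ⟨l, by simp⟩
    rcases List.prefix_or_prefix_of_prefix ((List.prefix_append _ _).trans hp)
      ((List.prefix_append _ _).trans hp') with hc | hc
    · exact incomparable h hh h' hh' hne hc
    · exact incomparable h' hh' h hh hne.symm hc
  · rw [Finset.sum_eq_zero fun h hh => ?_]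
    · exact G.pathWeight_nonneg (fun g b hb => G.steeredProb_nonneg σ i s a hb)
        (G.terminals_subset hz)
    · rw [reach_eq_zero _ _ _ fun hp => hex ⟨h, hh, hp⟩, zero_mul]

theorem exists_terminal : G.terminals.Nonempty := by
  obtain ⟨z, hz, hmax⟩ := G.hist.exists_max_image List.length ⟨[], G.nil_mem⟩
  refine ⟨z, Finset.mem_filter.2 ⟨hz, Finset.eq_empty_of_forall_notMem fun a ha => ?_⟩⟩
  have := hmax _ (G.mem_actionsAt.1 ha)
  simp at this

/-- Counterfactual values are bounded by the range of the utilities. -/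
theorem abs_cfValue_le {U : ℝ} (hU : ∀ z ∈ G.terminals, |G.utility z| ≤ U) (σ : G.Profile)
    {i : Fin 2} {s : Finset (List α)} (hs : s ∈ G.infoStates i) (a : α) :
    |G.cfValue i σ s a| ≤ U := by
  obtain ⟨z₀, hz₀⟩ := G.exists_terminal
  have hU0 : 0 ≤ U := (abs_nonneg _).trans (hU z₀ hz₀)
  calc |G.cfValue i σ s a|
      ≤ ∑ h ∈ s, ∑ z ∈ G.terminals, |G.reach σ {some i} (h ++ [a]) z *
          G.reach σ {some i}ᶜ [] z * G.payoff i z| :=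
        (Finset.abs_sum_le_sum_abs _ _).trans
          (Finset.sum_le_sum fun h _ => Finset.abs_sum_le_sum_abs _ _)
    _ ≤ ∑ h ∈ s, ∑ z ∈ G.terminals, G.reach σ {some i} (h ++ [a]) z *
          G.reach σ {some i}ᶜ [] z * U := by
        refine Finset.sum_le_sum fun h _ => Finset.sum_le_sum fun z hz => ?_
        have hn := mul_nonneg
          (G.reach_nonneg σ {some i} (h := h ++ [a]) (G.terminals_subset hz))
          (G.reach_nonneg σ {some i}ᶜ (h := []) (G.terminals_subset hz))
        rw [abs_mul, abs_of_nonneg hn]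
        refine mul_le_mul_of_nonneg_left ?_ hn
        unfold payoff
        split_ifs
        · exact hU z hz
        · rw [abs_neg]
          exact hU z hz
    _ ≤ 1 * U := by
        simp only [← Finset.sum_mul]
        exact mul_le_mul_of_nonneg_right (G.sum_reach_le_one σ hs a) hU0
    _ = U := one_mul U

/-! ### Regret bounds and the conclusion -/

theorem actions_nonempty {i : Fin 2} {s : Finset (List α)} (hs : s ∈ G.infoStates i) :
    (G.actions s).Nonempty := by
  obtain ⟨h, hh⟩ := G.nonempty_of_mem_infoStates hs
  rw [G.actions_eq hs hh]
  exact Finset.nonempty_iff_ne_empty.2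
    (Finset.mem_filter.1 (G.mem_playerHist_of_mem hs hh)).2.1

/-- The cumulative counterfactual regrets of regret matching with estimated regrets. -/
theorem cumRegret_le {p U : ℝ} (hp : 2 < p)
    (hU : ∀ (σ : G.Profile) (i : Fin 2), ∀ s ∈ G.infoStates i, ∀ a ∈ G.actions s,
      |G.cfValue i σ s a| ≤ U)
    {d : ℕ} {φ : Finset (List α) → α → (Fin d → ℝ)} {y : ℕ → (Fin d → ℝ) → ℝ}
    {σ : ℕ → G.Profile} (hσ : G.IsRCFR (fun _ => polyLink p) φ y σ) (t : ℕ) {i : Fin 2}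
    {s : Finset (List α)} (hs : s ∈ G.infoStates i) (a : G.actions s) :
    G.cumRegret i σ t s a ≤
      √((t : ℝ) * (p - 1) * 4 * U ^ 2 * (((G.actions s).card : ℝ) - 1) ^ (2 / p) +
        2 * U * G.approxError p φ y σ t i s) := by
  have hbound := polyPotential_regret_le (ι := G.actions s) (U := U) hp
    (v := fun k a => G.cfValue i (σ k) s a) (w := fun k a => (σ k i).prob s a)
    (x := fun k => G.regretEst φ (y k) s) (R := fun k => G.cumRegret i σ k s)
    (fun k a => hU (σ k) i s hs a a.2) (fun k a => (σ k i).nonneg s hs a a.2)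
    (fun k => by
      rw [Finset.sum_coe_sort (G.actions s) fun a => (σ k i).prob s a]
      exact (σ k i).sum_eq_one s hs)
    (fun k hk a => hσ k i s hs hk a)
    (by ext a; simp [cumRegret])
    (fun k a => by
      rw [Finset.sum_coe_sort (G.actions s) fun b => (σ k i).prob s b * G.cfValue i (σ k) s b,
        cumRegret, Finset.sum_range_succ]
      rfl) t
  rw [Fintype.card_coe] at hbound
  exact (le_max_left _ _).trans ((max_zero_le_sqrt_polyPotential hp _ a).trans
    (Real.sqrt_le_sqrt hbound))

/-- The cumulative gain of a fixed policy is at most the sum of the bounds on the counterfactual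
regrets. -/
theorem sum_value_update_sub_le {σ : ℕ → G.Profile} {t : ℕ} {i : Fin 2}
    {B : Finset (List α) → ℝ} (hB0 : ∀ s, 0 ≤ B s)
    (hB : ∀ s ∈ G.infoStates i, ∀ a : G.actions s, G.cumRegret i σ t s a ≤ B s)
    (τ : G.Strategy i) :
    ∑ k ∈ Finset.range t, (G.value i (Function.update (σ k) i τ) - G.value i (σ k)) ≤
      ∑ s ∈ G.infoStates i, B s := by
  simp only [value_update_sub]
  rw [Finset.sum_comm]
  refine Finset.sum_le_sum fun s hs => ?_
  rw [← Finset.mul_sum, Finset.sum_comm]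
  simp only [← Finset.mul_sum]
  have h1 : ∑ a ∈ G.actions s, τ.prob s a * ∑ k ∈ Finset.range t, G.cfRegret i (σ k) s a ≤ B s := by
    calc ∑ a ∈ G.actions s, τ.prob s a * ∑ k ∈ Finset.range t, G.cfRegret i (σ k) s a
        ≤ ∑ a ∈ G.actions s, τ.prob s a * B s := Finset.sum_le_sum fun a ha =>
          mul_le_mul_of_nonneg_left (hB s hs ⟨a, ha⟩) (τ.nonneg s hs a ha)
      _ = B s := by rw [← Finset.sum_mul, τ.sum_eq_one s hs, one_mul]
  obtain ⟨h, hh⟩ := G.nonempty_of_mem_infoStates hs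
  have hh' : h ∈ G.hist := (Finset.mem_filter.1 (G.mem_playerHist_of_mem hs hh)).1
  rw [G.infoReach_eq τ hs hh]
  -- Dropping the reach factor is legitimate because the bound `B s` is nonnegative, whatever the
  -- sign of the regret.
  calc _ ≤ G.ownReach τ h * B s := mul_le_mul_of_nonneg_left h1 (G.ownReach_nonneg τ hh')
    _ ≤ B s := mul_le_of_le_one_left (hB0 s) (G.ownReach_le_one τ hh')

theorem regretBound_nonneg (p U : ℝ) {d : ℕ} (φ : Finset (List α) → α → (Fin d → ℝ))
    (y : ℕ → (Fin d → ℝ) → ℝ) (σ : ℕ → G.Profile) (t : ℕ) (i : Fin 2) :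
    0 ≤ G.regretBound p U φ y σ t i :=
  mul_nonneg (by positivity) (Finset.sum_nonneg fun _ _ => Real.sqrt_nonneg _)

/-- Monotonicity term by term. The sign of `U` is needed only at an existing state; without states
both sides are `0`. -/
theorem regretBound_le {p U : ℝ} (hp : 2 < p)
    (hU : ∀ i : Fin 2, (G.infoStates i).Nonempty → 0 ≤ U) {d : ℕ}
    (φ : Finset (List α) → α → (Fin d → ℝ)) (y : ℕ → (Fin d → ℝ) → ℝ) (σ : ℕ → G.Profile)
    (t : ℕ) (i : Fin 2) :
    G.regretBound p U φ y σ t i ≤ 1 / (t : ℝ) * ((G.infoStates i).card : ℝ) *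
      √((t : ℝ) * (p - 1) * 4 * U ^ 2 * ((Fintype.card α : ℝ) - 1) ^ (2 / p) +
        2 * U * ⨆ s : G.infoStates i, G.approxError p φ y σ t i s.1) := by
  rw [regretBound, mul_assoc (1 / (t : ℝ))]
  refine mul_le_mul_of_nonneg_left ?_ (one_div_nonneg.2 t.cast_nonneg)
  refine (Finset.sum_le_card_nsmul _ _ _ fun s hs =>
    Real.sqrt_le_sqrt (add_le_add ?_ ?_)).trans_eq (nsmul_eq_mul _ _)
  · have h1 : (1 : ℝ) ≤ (G.actions s).card := by
      exact_mod_cast Finset.card_pos.2 (G.actions_nonempty hs)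
    have h2 : ((G.actions s).card : ℝ) ≤ Fintype.card α := by
      exact_mod_cast Finset.card_le_univ _
    refine mul_le_mul_of_nonneg_left
      (Real.rpow_le_rpow (by linarith) (by linarith) (by positivity)) ?_
    have : 0 ≤ p - 1 := by linarith
    positivity
  · refine mul_le_mul_of_nonneg_left ?_ (by linarith [hU i ⟨s, hs⟩])
    exact le_ciSup (f := fun s : G.infoStates i => G.approxError p φ y σ t i s.1)
      (Set.finite_range _).bddAbove ⟨s, hs⟩

end ZeroSumEFG

theorem mainTheorem8 {α : Type*} [DecidableEq α] [Fintype α] (G : ZeroSumEFG α)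
    (p : ℝ) (hp : 2 < p) (U : ℝ)
    -- `U` bounds the utilities, or it bounds the rewards (counterfactual values) of the learners
    (hU : (∀ z ∈ G.terminals, |G.utility z| ≤ U) ∨
      (∀ (σ : G.Profile) (i : Fin 2), ∀ s ∈ G.infoStates i, ∀ a ∈ G.actions s,
        |G.cfValue i σ s a| ≤ U))
    {d : ℕ} (φ : Finset (List α) → α → (Fin d → ℝ)) (y : ℕ → (Fin d → ℝ) → ℝ)
    (σ : ℕ → G.Profile) (hσ : G.IsRCFR (fun _ => polyLink p) φ y σ)
    (t : ℕ) (ht : 0 < t) :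
    (∀ i : Fin 2, 1 / (t : ℝ) * G.externalRegret i σ t ≤ G.regretBound p U φ y σ t i) ∧
    (∀ i : Fin 2, G.regretBound p U φ y σ t i ≤
      1 / (t : ℝ) * ((G.infoStates i).card : ℝ) *
        √((t : ℝ) * (p - 1) * 4 * U ^ 2 * ((Fintype.card α : ℝ) - 1) ^ (2 / p) +
          2 * U * ⨆ s : G.infoStates i, G.approxError p φ y σ t i s.1)) ∧
    (∀ σbar : G.Profile, G.IsAverage σ t σbar →
      G.IsNash (G.regretBound p U φ y σ t 0 + G.regretBound p U φ y σ t 1) σbar) := by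
  have hv : ∀ (σ : G.Profile) (i : Fin 2), ∀ s ∈ G.infoStates i, ∀ a ∈ G.actions s,
      |G.cfValue i σ s a| ≤ U := by
    rcases hU with hU | hU
    · exact fun σ i s hs a _ => G.abs_cfValue_le hU σ hs a
    · exact hU
  have hU0 : ∀ i : Fin 2, (G.infoStates i).Nonempty → 0 ≤ U := by
    rintro i ⟨s, hs⟩
    obtain ⟨a, ha⟩ := G.actions_nonempty hs
    exact (abs_nonneg _).trans (hv (σ 0) i s hs a ha)
  have ht' : (0 : ℝ) < t := by exact_mod_cast ht
  -- Stated for all policies `τ`: pure ones give the external regret, general ones the equilibrium.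
  have hgain : ∀ (i : Fin 2) (τ : G.Strategy i), ∑ k ∈ Finset.range t,
      (G.value i (Function.update (σ k) i τ) - G.value i (σ k)) ≤
        t * G.regretBound p U φ y σ t i := by
    intro i τ
    refine (G.sum_value_update_sub_le (fun s => Real.sqrt_nonneg _)
      (fun s hs a => G.cumRegret_le hp hv hσ t hs a) τ).trans_eq ?_
    rw [ZeroSumEFG.regretBound, ← mul_assoc, mul_one_div_cancel ht'.ne', one_mul]
  refine ⟨fun i => ?_, fun i => G.regretBound_le hp hU0 φ y σ t i,
    fun σbar hav => hav.isNash ht hgain⟩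
  rw [one_div, inv_mul_le_iff₀ ht']
  -- With a nonnegative bound no pure strategy has to be exhibited, since an empty real supremum is
  -- `0`.
  refine Real.iSup_le (fun a => ?_) (mul_nonneg ht'.le (G.regretBound_nonneg p U φ y σ t i))
  simp only [G.pureRegret_eq]
  exact hgain i a.toStrategy
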